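/- **Theorem (Dynamic index for multi-line costly exploration).** Consider $m$ disjoint directed lines; line $j$ consists of nodes $(j,1)\to(j,2)\to\dots\to(j,n_j)$. Node $(j,k)$ has a random loss $\ell_{j,k}>0$ with values in a finite set $V\subset(0,\infty)$ and a deterministic probing cost $c_{j,k}>0$ (the cost of the unique edge entering it). The loss vectors of different lines are independent, and along each line the losses form a (not necessarily homogeneous) Markov chain: given $\ell_{j,k}$, the loss $\ell_{j,k+1}$ is independent of $\ell_{j,1},\dots,\ell_{j,k-1}$. Let $\lambda\in[0,1]$ be a trade-off parameter, and put $R_{j,k}=\lambda\ell_{j,k}$, $\bar c_{j,k}=(1-\lambda)c_{j,k}$. A policy, knowing the joint law, at each step either stops or probes an available node (the first unprobed node of some line), as a function of the order of the earlier probes and of the losses they revealed. If $O$ is the set of nodes probed when it stops, its expected loss is $\mathbb E\big[\min_{v\in O}R_v+\sum_{v\in O}\bar c_v\big]$, with $\min\emptyset=\infty$. A policy is optimal if no policy has smaller expected loss. For a node $(j,i)$ and a possible value $s$ of $\ell_{j,i-1}$ (no conditioning if $i=1$), the dynamic index $\sigma_{j,i}(s)$ is the smallest $\sigma\ge 0$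 with $$\max_{\tau}\ \mathbb E\Big[\Big(\sigma-\min_{i\le k\le\tau}R_{j,k}\Big)_+-\sum_{k=i}^{\tau}\bar c_{j,k}\ \Big|\ \ell_{j,i-1}=s\Big]=0 ,$$ where $\tau$ ranges over the stopping times of line $j$ with $i\le\tau\le n_j$ (so that node $(j,i)$ is probed). The current index of an available node is its dynamic index given the last loss revealed on its line. A dynamic index policy is a policy that almost surely acts as follows at every step, where $X$ is the minimum of the $R_v$ over the probed nodes ($X=\infty$ if there are none): if it probes, it probes an available node whose current index is the smallest among all available nodes and is at most $X$; if it stops, $X$ is at most the current index of every available node. Ties are broken arbitrarily. Then the dynamic index is well defined (the smallest solution and the maximum exist, for every node and every value $s$ of positive probability), dynamic index policies exist, and every dynamic index policy is optimal. -/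

import Mathlib

open MeasureTheory ProbabilityTheory
open scoped ENNReal

noncomputable section

/-- A Markovian costly exploration instance in the multi-line setting, on the probability space
`(Ω, μ)`.  The nodes are the pairs `(j, k)` with `j : Fin m` a line and `k : Fin (len j)` the
position on that line; line `j` is the directed path `(j, 0) → (j, 1) → ⋯`.  Every node has exactly
one parent (its predecessor, or the dummy root), so the cost of the edge entering a node is recorded
at the node. -/
structure MultiLineInstance (Ω : Type*) [MeasurableSpace Ω] (μ : Measure Ω) where
  /-- number of lines -/
  m : ℕ
  /-- number of nodes on each line -/
  len : Fin m → ℕ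
  /-- the random loss of each node -/
  loss : (j : Fin m) → Fin (len j) → Ω → ℝ
  /-- the cost of probing each node -/
  cost : (j : Fin m) → Fin (len j) → ℝ
  /-- the trade-off parameter between losses and costs -/
  lam : ℝ
  /-- the common finite support of the losses -/
  support : Finset ℝ
  lam_mem : lam ∈ Set.Icc (0 : ℝ) 1
  support_pos : ∀ v ∈ support, 0 < v
  cost_pos : ∀ j k, 0 < cost j k
  loss_measurable : ∀ j k, Measurable (loss j k)
  loss_mem : ∀ j k ω, loss j k ω ∈ support
  /-- Markov property along each line: given the loss of a node, the loss of the next node is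
  independent of the losses of all earlier nodes of the line. -/
  markov : ∀ (j : Fin m) (k k' : Fin (len j)), (k' : ℕ) = k + 1 →
    ∀ (x : Fin (len j) → ℝ) (v : ℝ), μ {ω | ∀ i ≤ k, loss j i ω = x i} ≠ 0 →
      μ[{ω | loss j k' ω = v} | {ω | ∀ i ≤ k, loss j i ω = x i}]
        = μ[{ω | loss j k' ω = v} | {ω | loss j k ω = x k}]
  /-- the loss vectors of the different lines are mutually independent -/
  indep : iIndepFun (fun (j : Fin m) (ω : Ω) (k : Fin (len j)) => loss j k ω) μ

namespace MultiLineInstance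

variable {Ω : Type*} [MeasurableSpace Ω] {μ : Measure Ω} (I : MultiLineInstance Ω μ)

/-! ### Policies and their expected loss -/

/-- What has been observed so far: the list, most recent probe first, of the lines that were probed
together with the losses that were revealed. -/
abbrev History : Type := List (Fin I.m × ℝ)

/-- An adaptive policy: given the history, either stop (`none`) or probe the first unprobed node of
line `j` (`some j`).  Naming a line all of whose nodes have been probed amounts to stopping. -/
abbrev Policy : Type := I.History → Option (Fin I.m)

/-- The number of nodes of line `j` probed so far. -/
def probed (h : I.History) (j : Fin I.m) : ℕ := (h.map Prod.fst).count j

/-- The most recently revealed loss on line `j` (`0`, and never used, if there is none). -/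
def lastLoss : I.History → Fin I.m → ℝ
  | [], _ => 0
  | (j', r) :: h, j => if j' = j then r else lastLoss h j

/-- The current minimum weighted loss, `∞` if nothing has been probed. -/
def bestLoss (h : I.History) : ℝ≥0∞ := ⨅ p ∈ h, ENNReal.ofReal (I.lam * p.2)

/-- The total weighted cost of the nodes probed so far. -/
def paidCost (h : I.History) : ℝ :=
  ∑ j : Fin I.m, ∑ k : Fin (I.len j), if (k : ℕ) < I.probed h j then (1 - I.lam) * I.cost j k else 0

/-- One step of the policy `π` in the scenario `ω`. -/
def step (π : I.Policy) (ω : Ω) (h : I.History) : I.History :=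
  match π h with
  | none => h
  | some j => if hj : I.probed h j < I.len j then (j, I.loss j ⟨I.probed h j, hj⟩ ω) :: h else h

/-- The history of the policy `π` in the scenario `ω` after `t` steps. -/
def run (π : I.Policy) (ω : Ω) : ℕ → I.History
  | 0 => []
  | t + 1 => I.step π ω (run π ω t)

/-- The history when `π` has stopped: since each step before stopping probes a new node, there are
at most as many steps as nodes. -/
def finalHistory (π : I.Policy) (ω : Ω) : I.History := I.run π ω (∑ j, I.len j)

/-- The expected with-recall loss of a policy: expectation of the weighted minimum loss over the
probed nodes plus the weighted cost of all probed nodes. -/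
def expectedLoss (π : I.Policy) : ℝ≥0∞ :=
  ∫⁻ ω, (I.bestLoss (I.finalHistory π ω) + ENNReal.ofReal (I.paidCost (I.finalHistory π ω))) ∂μ

/-- `π` is (online) optimal: no policy has smaller expected loss. -/
def IsOptimal (π : I.Policy) : Prop := ∀ π' : I.Policy, I.expectedLoss π ≤ I.expectedLoss π'

/-! ### The dynamic index -/

/-- The information revealed along line `j`. -/
def lineFiltration (j : Fin I.m) : Filtration (Fin (I.len j)) ‹MeasurableSpace Ω› :=
  Filtration.natural (I.loss j) fun k => (I.loss_measurable j k).stronglyMeasurable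

/-- The event that the predecessor of node `i` on line `j` has loss `s` (everything, if `i` is the
first node of its line). -/
def prevEvent (j : Fin I.m) (i : Fin (I.len j)) (s : ℝ) : Set Ω :=
  {ω | ∀ k : Fin (I.len j), (k : ℕ) + 1 = i → I.loss j k ω = s}

/-- The stopping times for line `j` that probe node `i`. -/
def lineStoppingTimes (j : Fin I.m) (i : Fin (I.len j)) : Set (Ω → Fin (I.len j)) :=
  {τ | IsStoppingTime (I.lineFiltration j) (fun ω => (τ ω : WithTop (Fin (I.len j)))) ∧
    ∀ ω, i ≤ τ ω}

/-- `E[(σ - min_{i ≤ k ≤ τ} R_k)₊ - ∑_{i ≤ k ≤ τ} c_k | R_{i-1} = s]` for line `j`, where `R` and `c`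
are the weighted losses and costs: the expected gain over the sure loss `σ` of probing the nodes
`i, …, τ` of the line with recall. -/
def gain (j : Fin I.m) (i : Fin (I.len j)) (s σ : ℝ) (τ : Ω → Fin (I.len j)) : ℝ :=
  ∫ ω, (max (σ - ⨅ k : Set.Icc i (τ ω), I.lam * I.loss j k ω) 0
      - ∑ k ∈ Finset.Icc i (τ ω), (1 - I.lam) * I.cost j k) ∂(μ[|I.prevEvent j i s])

/-- The levels `σ ≥ 0` at which an optimal stopping time among those that probe node `i` has expected
gain zero, that is, at which one is indifferent between stopping with loss `σ` and probing on. -/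
def indexSolutions (j : Fin I.m) (i : Fin (I.len j)) (s : ℝ) : Set ℝ :=
  {σ | 0 ≤ σ ∧ IsGreatest (I.gain j i s σ '' I.lineStoppingTimes j i) 0}

/-- The dynamic index of node `i` of line `j` when its predecessor has loss `s`: the smallest
indifference level. -/
def dynamicIndex (j : Fin I.m) (i : Fin (I.len j)) (s : ℝ) : ℝ := sInf (I.indexSolutions j i s)

/-! ### Index policies -/

/-- The current index of line `j`: the dynamic index of its first unprobed node, `∞` if there is
none. -/
def currentIndex (h : I.History) (j : Fin I.m) : ℝ≥0∞ :=
  if hj : I.probed h j < I.len j then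
    ENNReal.ofReal (I.dynamicIndex j ⟨I.probed h j, hj⟩ (I.lastLoss h j))
  else ∞

/-- The index rule at history `h`: if the policy probes, it probes an available node whose current
index is minimal and does not exceed the current minimum loss; if it stops, the current minimum loss
does not exceed any current index.  Ties are broken arbitrarily. -/
def FollowsIndexAt (π : I.Policy) (h : I.History) : Prop :=
  match π h with
  | some j => I.probed h j < I.len j ∧ (∀ k, I.currentIndex h j ≤ I.currentIndex h k) ∧
      I.currentIndex h j ≤ I.bestLoss h
  | none => ∀ k, I.bestLoss h ≤ I.currentIndex h k

/-- `π` is a dynamic index policy: almost surely it obeys the index rule at every step. -/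
def IsIndexPolicy (π : I.Policy) : Prop := ∀ᵐ ω ∂μ, ∀ t : ℕ, I.FollowsIndexAt π (I.run π ω t)

end MultiLineInstance

end

/-! The proof replaces every line by a surrogate loss, as in Weitzman's Pandora problem. Writing
`σ_i` for the index of node `i`, the remainder of a line from `i` on gets `W_i = max σ_i (min R_i
W_{i+1})`, with `W = ∞` past the end; `afterProbe` is `Z_i = min R_i W_{i+1}`. The central fact
(`fair`) is that the index balances cost and improvement: given the predecessor's loss, `E (σ_i -
Z_i)₊` equals the weighted cost of node `i`.

The potential of a history is the minimum of the best loss `X` and all surrogate losses, plus the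
cost paid. By `min_max_eq_add_sub`, probing replaces `W_i` by `Z_i` at a saving of at most `(σ_i -
Z_i)₊`, and of exactly that if `σ_i` is at most every alternative. Hence the expected potential
never decreases under any policy and is constant under an index policy
(`setLIntegral_potential_step`). The final potential is at most the loss incurred, with equality for
an index policy, since it stops only when `X` is below all indices and these are below the
surrogates. So the initial expected potential bounds every policy from below and is attained.

Fairness is proved by backward induction. If all later nodes are fair, the same argument on a single
line with outside option `σ` shows that the maximal gain is `E (σ - Z_i)₊` minus the cost
(`isGreatest_gain`). This is continuous in `σ`, so the indifference levels form a closed nonempty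
set and their minimum, the index, satisfies the balance equation. -/

namespace MultiLineInstance

/-! ### Functions of the losses, and events depending only on the past of a line. -/

section Determined

variable {Ω : Type*} [MeasurableSpace Ω] {μ : Measure Ω} (I : MultiLineInstance Ω μ)

/-- A function of the scenario that depends only on the losses. -/
def Determined {β : Type*} (f : Ω → β) : Prop :=
  ∀ ω ω', (∀ j k, I.loss j k ω = I.loss j k ω') → f ω = f ω'

/-- All losses, as elements of the finite support. -/
def lossTable (ω : Ω) (j : Fin I.m) (k : Fin (I.len j)) : I.support :=
  ⟨I.loss j k ω, I.loss_mem j k ω⟩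

lemma measurable_lossTable : Measurable I.lossTable :=
  measurable_pi_lambda _ fun j => measurable_pi_lambda _ fun k =>
    (I.loss_measurable j k).subtype_mk

variable {I}

lemma Determined.exists_eq_comp {β : Type*} [Nonempty β] {f : Ω → β} (hf : I.Determined f) :
    ∃ g, f = g ∘ I.lossTable := by
  have hft : Function.FactorsThrough f I.lossTable := fun ω ω' h => hf ω ω' fun j k =>
    congrArg Subtype.val (congrFun (congrFun h j) k)
  exact (Function.factorsThrough_iff f).1 hft

/-- The loss table lives in a finite discrete space, so any σ-algebra on the target will do. -/
lemma Determined.measurable {β : Type*} [MeasurableSpace β] {f : Ω → β} (hf : I.Determined f) :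
    Measurable f := by
  rcases isEmpty_or_nonempty β with h | h
  · exact measurable_of_empty_codomain f
  · obtain ⟨g, rfl⟩ := hf.exists_eq_comp
    exact (Measurable.of_discrete (f := g)).comp I.measurable_lossTable

lemma Determined.measurableSet {A : Set Ω} (hA : I.Determined fun ω => ω ∈ A) :
    MeasurableSet A :=
  measurableSet_setOfPred.2 hA.measurable

lemma Determined.finite_range {β : Type*} {f : Ω → β} (hf : I.Determined f) :
    (Set.range f).Finite := by
  rcases isEmpty_or_nonempty β with h | h
  · exact Set.toFinite _
  · obtain ⟨g, rfl⟩ := hf.exists_eq_comp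
    exact (Set.finite_range g).subset (Set.range_comp_subset_range _ _)

lemma Determined.preimage {β : Type*} {f : Ω → β} (hf : I.Determined f) (S : Set β) :
    I.Determined fun ω => ω ∈ f ⁻¹' S := fun ω ω' h => by
  simp only [Set.mem_preimage, hf ω ω' h]

/-- Stands in for conditioning on `f`. The finset is chosen before `A` and the integrand, so two
integrals split this way can be compared term by term. -/
lemma Determined.exists_setLIntegral_eq_sum {β : Type*} {f : Ω → β} (hf : I.Determined f) :
    ∃ H : Finset β, ∀ A : Set Ω, MeasurableSet A → ∀ g : Ω → ℝ≥0∞,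
      ∫⁻ ω in A, g ω ∂μ = ∑ w ∈ H, ∫⁻ ω in A ∩ f ⁻¹' {w}, g ω ∂μ := by
  refine ⟨hf.finite_range.toFinset, fun A hA g => ?_⟩
  rw [← lintegral_biUnion_finset]
  · congr 2
    ext ω
    simp
  · intro w _ w' _ hw
    refine Set.disjoint_left.2 fun ω h h' => hw ?_
    exact h.2.symm.trans h'.2
  · exact fun w _ => hA.inter (hf.preimage {w}).measurableSet

variable (I)

/-- An event that depends only on the losses on the other lines and on the first `i` losses on
line `j`. -/
def IsPast (j : Fin I.m) (i : ℕ) (A : Set Ω) : Prop :=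
  ∀ ω ω', (∀ j' (k : Fin (I.len j')), (j' = j → (k : ℕ) < i) → I.loss j' k ω = I.loss j' k ω') → ω ∈ A → ω' ∈ A

variable {I}

lemma IsPast.determined {j : Fin I.m} {i : ℕ} {A : Set Ω} (hA : I.IsPast j i A) :
    I.Determined fun ω => ω ∈ A := fun ω ω' h =>
  propext ⟨hA ω ω' fun j k _ => h j k, hA ω' ω fun j k _ => (h j k).symm⟩

lemma IsPast.measurableSet {j : Fin I.m} {i : ℕ} {A : Set Ω} (hA : I.IsPast j i A) :
    MeasurableSet A := hA.determined.measurableSet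

lemma IsPast.inter {j : Fin I.m} {i : ℕ} {A B : Set Ω} (hA : I.IsPast j i A)
    (hB : I.IsPast j i B) : I.IsPast j i (A ∩ B) :=
  fun ω ω' h hω => ⟨hA ω ω' h hω.1, hB ω ω' h hω.2⟩

lemma IsPast.mono {j : Fin I.m} {i i' : ℕ} (hi : i ≤ i') {A : Set Ω} (hA : I.IsPast j i A) :
    I.IsPast j i' A :=
  fun ω ω' h => hA ω ω' fun j' k hk => h j' k fun e => (hk e).trans_le hi

lemma isPast_loss_eq {j : Fin I.m} {i : ℕ} (k : Fin (I.len j)) (hk : (k : ℕ) < i) (v : ℝ) :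
    I.IsPast j i (I.loss j k ⁻¹' {v}) := fun ω ω' h hω => by
  rw [Set.mem_preimage, ← h j k fun _ => hk]
  exact hω

lemma determined_loss (j : Fin I.m) (k : Fin (I.len j)) : I.Determined (I.loss j k) :=
  fun _ _ h => h j k

lemma isPast_prevEvent (j : Fin I.m) (i : Fin (I.len j)) (s : ℝ) :
    I.IsPast j i (I.prevEvent j i s) := fun ω ω' h hω k hk => by
  rw [← h j k fun _ => by omega]
  exact hω k hk

end Determined

/-! ### The Markov property given the past on all lines. -/

section Markov

variable {Ω : Type*} [MeasurableSpace Ω] {μ : Measure Ω} [IsProbabilityMeasure μ]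
  {I : MultiLineInstance Ω μ}

/-- Merges the Markov hypothesis with two degenerate cases: the first node of a line, where nothing
is conditioned on, and prefixes of probability zero. -/
lemma measure_prefix_inter (j : Fin I.m) (i : Fin (I.len j)) (s : ℝ) (x : Fin (I.len j) → ℝ)
    (hx : ∀ k : Fin (I.len j), (k : ℕ) + 1 = i → x k = s) (v : ℝ) :
    μ ({ω | ∀ k < i, I.loss j k ω = x k} ∩ I.loss j i ⁻¹' {v})
      = μ {ω | ∀ k < i, I.loss j k ω = x k} * μ[I.loss j i ⁻¹' {v} | I.prevEvent j i s] := by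
  rcases Nat.eq_zero_or_pos (i : ℕ) with h0 | hpos
  · have h1 : {ω | ∀ k < i, I.loss j k ω = x k} = Set.univ :=
      Set.eq_univ_of_forall fun ω k hk => by
        have : (k : ℕ) < i := hk
        omega
    have h2 : I.prevEvent j i s = Set.univ :=
      Set.eq_univ_of_forall fun ω k hk => by omega
    rw [h1, h2]
    simp [cond_univ]
  · set p : Fin (I.len j) := ⟨i - 1, by omega⟩ with hp
    have hpi : (i : ℕ) = p + 1 := by simp [hp]; omega
    have h1 : {ω | ∀ k < i, I.loss j k ω = x k} = {ω | ∀ k ≤ p, I.loss j k ω = x k} := by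
      have : ∀ k, k < i ↔ k ≤ p := fun k => by
        rw [Fin.lt_def, Fin.le_def, hpi, Nat.lt_succ_iff]
      simp only [this]
    have h2 : I.prevEvent j i s = {ω | I.loss j p ω = x p} := by
      ext ω
      constructor
      · intro h
        rw [Set.mem_ofPred_eq, h p hpi.symm, hx p hpi.symm]
      · intro h k hk
        have : k = p := Fin.ext (by omega)
        rw [this, ← hx p hpi.symm]
        exact h
    rw [h1, h2]
    by_cases hB : μ {ω | ∀ k ≤ p, I.loss j k ω = x k} = 0
    · rw [hB, zero_mul]
      exact measure_mono_null Set.inter_subset_left hB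
    · have hm := I.markov j p i hpi x v hB
      have hmeas : MeasurableSet {ω | ∀ k ≤ p, I.loss j k ω = x k} :=
        Determined.measurableSet (I := I) fun ω ω' h => by simp only [Set.mem_ofPred_eq, h]
      change _ = _ * μ[{ω | I.loss j i ω = v} | _]
      rw [← hm, cond_apply hmeas, ← mul_assoc, ENNReal.mul_inv_cancel hB (measure_ne_top _ _),
        one_mul]
      rfl

/-- One step of the Markov property, given everything known on all lines. -/
lemma IsPast.measure_inter_loss_eq {j : Fin I.m} {i : Fin (I.len j)} {A : Set Ω}
    (hA : I.IsPast j i A) {s : ℝ} (hs : A ⊆ I.prevEvent j i s) (v : ℝ) :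
    μ (A ∩ I.loss j i ⁻¹' {v}) = μ A * μ[I.loss j i ⁻¹' {v} | I.prevEvent j i s] := by
  classical
  -- `M` records what a past event may depend on and masks the rest by `0`. The event `A` is a union
  -- of level sets of `M`, so one level set suffices.
  set M : Ω → (j' : Fin I.m) → Fin (I.len j') → ℝ := fun ω j' k =>
    if j' = j → (k : ℕ) < i then I.loss j' k ω else 0 with hM
  have hMdet : I.Determined M := fun ω ω' h => by simp only [hM, h]
  obtain ⟨H, hH⟩ := hMdet.exists_setLIntegral_eq_sum
  have hD : MeasurableSet (I.loss j i ⁻¹' {v}) :=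
    I.loss_measurable j i (measurableSet_singleton v)
  rw [← setLIntegral_one, ← setLIntegral_one, hH _ (hA.measurableSet.inter hD),
    hH _ hA.measurableSet, Finset.sum_mul]
  refine Finset.sum_congr rfl fun w _ => ?_
  rw [setLIntegral_one, setLIntegral_one]
  by_cases hw : ∃ ω₀ ∈ A, M ω₀ = w
  swap
  · have : A ∩ M ⁻¹' {w} = ∅ := Set.eq_empty_of_forall_notMem fun ω h => hw ⟨ω, h.1, h.2⟩
    rw [Set.inter_right_comm, this]
    simp
  obtain ⟨ω₀, hω₀, rfl⟩ := hw
  have hMiff : ∀ ω, M ω = M ω₀ ↔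
      ∀ j' (k : Fin (I.len j')), (j' = j → (k : ℕ) < i) → I.loss j' k ω = I.loss j' k ω₀ := by
    intro ω
    constructor
    · intro h j' k hk
      have := congrFun (congrFun h j') k
      simpa only [hM, if_pos hk] using this
    · intro h
      funext j' k
      by_cases hk : j' = j → (k : ℕ) < i
      · simp only [hM, if_pos hk, h j' k hk]
      · simp only [hM, if_neg hk]
  have hsub : A ∩ M ⁻¹' {M ω₀} = M ⁻¹' {M ω₀} := Set.inter_eq_right.2 fun ω h =>
    hA ω₀ ω (fun j' k hk => ((hMiff ω).1 h j' k hk).symm) hω₀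
  rw [Set.inter_right_comm, hsub]
  -- A level set of `M` is a product over the lines. Prescribing the loss of node `i` as well
  -- changes only the factor of line `j`, so independence reduces the claim to that line.
  let E : (j' : Fin I.m) → Set (Fin (I.len j') → ℝ) := fun j' =>
    {x | ∀ k : Fin (I.len j'), (j' = j → (k : ℕ) < i) → x k = I.loss j' k ω₀}
  let E' : (j' : Fin I.m) → Set (Fin (I.len j') → ℝ) := fun j' =>
    E j' ∩ {x | ∀ k : Fin (I.len j'), (j' = j ∧ (k : ℕ) = i) → x k = v}
  have hE : ∀ j', MeasurableSet (E j') := fun j' => by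
    simp only [E, Set.ofPred_forall]
    exact .iInter fun k => .iInter fun _ => measurableSet_eq_fun (by fun_prop) (by fun_prop)
  have hE' : ∀ j', MeasurableSet (E' j') := fun j' => by
    refine (hE j').inter ?_
    simp only [Set.ofPred_forall]
    exact .iInter fun k => .iInter fun _ => measurableSet_eq_fun (by fun_prop) (by fun_prop)
  have h1 : M ⁻¹' {M ω₀} =
      ⋂ j' ∈ Finset.univ, (fun (ω : Ω) (k : Fin (I.len j')) => I.loss j' k ω) ⁻¹' E j' := by
    ext ω
    simp only [Set.mem_preimage, Set.mem_singleton_iff, hMiff, Finset.mem_univ, Set.iInter_true,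
      Set.mem_iInter, E, Set.mem_ofPred_eq]
  have h2 : M ⁻¹' {M ω₀} ∩ I.loss j i ⁻¹' {v} =
      ⋂ j' ∈ Finset.univ, (fun (ω : Ω) (k : Fin (I.len j')) => I.loss j' k ω) ⁻¹' E' j' := by
    ext ω
    simp only [Set.mem_inter_iff, Set.mem_preimage, Set.mem_singleton_iff, hMiff, Finset.mem_univ,
      Set.iInter_true, Set.mem_iInter, E', E, Set.mem_ofPred_eq]
    constructor
    · rintro ⟨h, h'⟩ j'
      refine ⟨h j', ?_⟩
      rintro k ⟨rfl, hk⟩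
      rw [Fin.ext hk, h']
    · exact fun h => ⟨fun j' => (h j').1, (h j).2 i ⟨rfl, rfl⟩⟩
  have h3 := I.indep.measure_inter_preimage_eq_mul Finset.univ (sets := E) fun j' _ => hE j'
  have h4 := I.indep.measure_inter_preimage_eq_mul Finset.univ (sets := E') fun j' _ => hE' j'
  rw [h2, h4, h1, h3, ← Finset.mul_prod_erase _ _ (Finset.mem_univ j),
    ← Finset.mul_prod_erase (a := j) Finset.univ
      (fun j' => μ ((fun (ω : Ω) (k : Fin (I.len j')) => I.loss j' k ω) ⁻¹' E j'))
      (Finset.mem_univ j)]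
  have h5 : ∏ j' ∈ Finset.univ.erase j,
        μ ((fun (ω : Ω) (k : Fin (I.len j')) => I.loss j' k ω) ⁻¹' E' j')
      = ∏ j' ∈ Finset.univ.erase j,
        μ ((fun (ω : Ω) (k : Fin (I.len j')) => I.loss j' k ω) ⁻¹' E j') := by
    refine Finset.prod_congr rfl fun j' hj' => ?_
    have hne := Finset.ne_of_mem_erase hj'
    have : E' j' = E j' := Set.inter_eq_left.2 fun x _ k hk => absurd hk.1 hne
    rw [this]
  rw [h5, mul_right_comm]
  congr 1
  have h6 := measure_prefix_inter (μ := μ) j i s (fun k => I.loss j k ω₀)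
    (fun k hk => hs hω₀ k hk) v
  have h7 : (fun (ω : Ω) (k : Fin (I.len j)) => I.loss j k ω) ⁻¹' E j
      = {ω | ∀ k < i, I.loss j k ω = I.loss j k ω₀} := by
    ext ω
    simp [E]
  have h8 : (fun (ω : Ω) (k : Fin (I.len j)) => I.loss j k ω) ⁻¹' E' j
      = {ω | ∀ k < i, I.loss j k ω = I.loss j k ω₀} ∩ I.loss j i ⁻¹' {v} := by
    rw [← h7]
    ext ω
    simp only [E', Set.mem_preimage, Set.mem_inter_iff, Set.mem_ofPred_eq, true_and,
      Set.mem_singleton_iff, and_congr_right_iff]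
    exact fun _ => ⟨fun h => h i rfl, fun h k hk => by rw [Fin.ext hk, h]⟩
  rw [h8, h7, h6]

/-- The conditional expectation of a function of the losses on line `j` from node `i` on, given the
past, depends only on the loss of the predecessor of `i`. -/
lemma exists_setLIntegral_future_eq (j : Fin I.m) (i : ℕ) (f : (Fin (I.len j) → ℝ) → ℝ≥0∞)
    (hf : ∀ x x', (∀ k : Fin (I.len j), i ≤ k → x k = x' k) → f x = f x') (s : ℝ) :
    ∃ e : ℝ≥0∞, ∀ A : Set Ω, I.IsPast j i A →
      (∀ ω ∈ A, ∀ k : Fin (I.len j), (k : ℕ) + 1 = i → I.loss j k ω = s) →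
      ∫⁻ ω in A, f (I.loss j · ω) ∂μ = e * μ A := by
  induction hd : I.len j - i generalizing i f s with
  | zero =>
    refine ⟨f 0, fun A _ _ => ?_⟩
    have : ∀ x, f x = f 0 := fun x => hf x 0 fun k hk => by omega
    simp only [this, lintegral_const, Measure.restrict_apply_univ]
  | succ d ih =>
    have hi : i < I.len j := by omega
    obtain ⟨H, hH⟩ := (determined_loss (I := I) j ⟨i, hi⟩).exists_setLIntegral_eq_sum
    -- Freezing the loss of node `i` at `v` leaves a function of the later nodes, for which `v` is
    -- the predecessor's loss.
    choose e he using fun v : ℝ => ih (i + 1) (fun x => f (Function.update x ⟨i, hi⟩ v))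
      (fun x x' h => hf _ _ fun k hk => by
        by_cases hki : k = ⟨i, hi⟩
        · subst hki; simp
        · rw [Function.update_of_ne hki, Function.update_of_ne hki]
          refine h k ?_
          have : (k : ℕ) ≠ i := fun h => hki (Fin.ext h)
          omega) v (by omega)
    refine ⟨∑ v ∈ H, e v * μ[I.loss j ⟨i, hi⟩ ⁻¹' {v} | I.prevEvent j ⟨i, hi⟩ s],
      fun A hA hs => ?_⟩
    rw [hH A hA.measurableSet, Finset.sum_mul]
    refine Finset.sum_congr rfl fun v _ => ?_
    have hB : I.IsPast j (i + 1) (A ∩ I.loss j ⟨i, hi⟩ ⁻¹' {v}) :=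
      (hA.mono (Nat.le_succ i)).inter (isPast_loss_eq _ (Nat.lt_succ_self i) v)
    have h1 : ∫⁻ ω in A ∩ I.loss j ⟨i, hi⟩ ⁻¹' {v}, f (I.loss j · ω) ∂μ
        = ∫⁻ ω in A ∩ I.loss j ⟨i, hi⟩ ⁻¹' {v},
            f (Function.update (I.loss j · ω) ⟨i, hi⟩ v) ∂μ := by
      refine setLIntegral_congr_fun hB.measurableSet fun ω hω => ?_
      have : Function.update (I.loss j · ω) ⟨i, hi⟩ v = (I.loss j · ω) := by
        rw [Function.update_eq_self_iff]
        exact hω.2.symm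
      simp only [this]
    rw [h1, he v _ hB fun ω hω k hk => ?_, hA.measure_inter_loss_eq (i := ⟨i, hi⟩) hs v]
    · ring
    · have : k = ⟨i, hi⟩ := Fin.ext (by simpa using hk)
      rw [this]
      exact hω.2

end Markov

/-! ### Surrogate losses of the remainder of a line. -/

section Surrogate

variable {Ω : Type*} [MeasurableSpace Ω] {μ : Measure Ω} (I : MultiLineInstance Ω μ)

/-- The loss of the predecessor of node `i` if the losses on line `j` are `x`, and `0` if there is
no predecessor. -/
noncomputable def prevLoss (j : Fin I.m) (i : ℕ) (x : Fin (I.len j) → ℝ) : ℝ :=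
  if h : 0 < i ∧ i - 1 < I.len j then x ⟨i - 1, h.2⟩ else 0

/-- The index of node `i` of line `j` if the losses on the line are `x`, and `∞` past the end. -/
noncomputable def indexAt (j : Fin I.m) (i : ℕ) (x : Fin (I.len j) → ℝ) : ℝ≥0∞ :=
  if h : i < I.len j then ENNReal.ofReal (I.dynamicIndex j ⟨i, h⟩ (I.prevLoss j i x)) else ∞

/-- The surrogate loss of what remains of line `j` from node `i` on: the minimum over `k ≥ i` of
the larger of the weighted loss of `k` and the indices of the nodes `i, …, k`. -/
noncomputable def surrogate (j : Fin I.m) (i : ℕ) (x : Fin (I.len j) → ℝ) : ℝ≥0∞ :=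
  if h : i < I.len j then
    max (I.indexAt j i x) (min (ENNReal.ofReal (I.lam * x ⟨i, h⟩)) (surrogate j (i + 1) x))
  else ∞
termination_by I.len j - i

/-- The surrogate loss of what remains of line `j` after probing node `i`. -/
noncomputable def afterProbe (j : Fin I.m) (i : Fin (I.len j)) (x : Fin (I.len j) → ℝ) : ℝ≥0∞ :=
  min (ENNReal.ofReal (I.lam * x i)) (I.surrogate j (i + 1) x)

variable {I}

lemma surrogate_eq_max (j : Fin I.m) (i : Fin (I.len j)) (x : Fin (I.len j) → ℝ) :
    I.surrogate j i x = max (I.indexAt j i x) (I.afterProbe j i x) := by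
  rw [surrogate, dif_pos i.2, afterProbe]

lemma surrogate_of_len_le {j : Fin I.m} {i : ℕ} (hi : I.len j ≤ i) (x : Fin (I.len j) → ℝ) :
    I.surrogate j i x = ∞ := by
  rw [surrogate, dif_neg hi.not_gt]

lemma indexAt_le_surrogate (j : Fin I.m) (i : ℕ) (x : Fin (I.len j) → ℝ) :
    I.indexAt j i x ≤ I.surrogate j i x := by
  by_cases h : i < I.len j
  · exact (surrogate_eq_max j ⟨i, h⟩ x).symm ▸ le_max_left _ _
  · rw [surrogate_of_len_le (not_lt.1 h)]
    exact le_top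

lemma prevLoss_congr {j : Fin I.m} {i : ℕ} {x x' : Fin (I.len j) → ℝ}
    (h : ∀ k : Fin (I.len j), (k : ℕ) + 1 = i → x k = x' k) :
    I.prevLoss j i x = I.prevLoss j i x' := by
  unfold prevLoss
  split_ifs with hi
  · exact h _ (Nat.sub_add_cancel hi.1)
  · rfl

lemma indexAt_congr {j : Fin I.m} {i : ℕ} {x x' : Fin (I.len j) → ℝ}
    (h : ∀ k : Fin (I.len j), (k : ℕ) + 1 = i → x k = x' k) :
    I.indexAt j i x = I.indexAt j i x' := by
  rw [indexAt, indexAt, prevLoss_congr h]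

/-- The bound is `i ≤ k + 1` because the index of node `i` reads the loss of node `i - 1`. -/
lemma surrogate_congr {j : Fin I.m} {i : ℕ} {x x' : Fin (I.len j) → ℝ}
    (h : ∀ k : Fin (I.len j), i ≤ (k : ℕ) + 1 → x k = x' k) :
    I.surrogate j i x = I.surrogate j i x' := by
  induction hd : I.len j - i generalizing i with
  | zero => rw [surrogate_of_len_le (by omega), surrogate_of_len_le (by omega)]
  | succ d ih =>
    have hi : i < I.len j := by omega
    refine (surrogate_eq_max j ⟨i, hi⟩ x).trans
      (Eq.trans ?_ (surrogate_eq_max j ⟨i, hi⟩ x').symm)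
    simp only [afterProbe]
    rw [ih (fun k hk => h k (by omega)) (by omega), h ⟨i, hi⟩ (Nat.le_succ i),
      indexAt_congr fun k hk => h k hk.ge]

/-- Without the index of node `i`, the predecessor's loss no longer enters; this is what makes
`exists_setLIntegral_future_eq` applicable. -/
lemma afterProbe_congr {j : Fin I.m} {i : Fin (I.len j)} {x x' : Fin (I.len j) → ℝ}
    (h : ∀ k : Fin (I.len j), i ≤ k → x k = x' k) :
    I.afterProbe j i x = I.afterProbe j i x' := by
  rw [afterProbe, afterProbe, h i le_rfl,
    surrogate_congr fun k hk => h k (Fin.le_def.2 (Nat.succ_le_succ_iff.1 hk))]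

lemma determined_path {β : Type*} (j : Fin I.m) (f : (Fin (I.len j) → ℝ) → β) :
    I.Determined fun ω => f (I.loss j · ω) := fun ω ω' h => by simp only [h]

lemma measurable_path {β : Type*} [MeasurableSpace β] (j : Fin I.m)
    (f : (Fin (I.len j) → ℝ) → β) : Measurable fun ω => f (I.loss j · ω) :=
  (determined_path j f).measurable

lemma mem_prevEvent_prevLoss (j : Fin I.m) (i : Fin (I.len j)) (ω : Ω) :
    ω ∈ I.prevEvent j i (I.prevLoss j i (I.loss j · ω)) := fun k hk => by
  have h : 0 < (i : ℕ) ∧ (i : ℕ) - 1 < I.len j := ⟨by omega, by omega⟩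
  rw [prevLoss, dif_pos h]
  congr 1
  exact Fin.ext (by simp; omega)

end Surrogate

/-! ### Fairness of a node and its effect on the surrogate loss. -/

section Fair

variable {Ω : Type*} [MeasurableSpace Ω] {μ : Measure Ω} (I : MultiLineInstance Ω μ)

/-- The weighted cost of a node. -/
noncomputable def wcost (j : Fin I.m) (i : Fin (I.len j)) : ℝ := (1 - I.lam) * I.cost j i

/-- The index of node `i` makes the expected improvement by probing `i` equal to its cost. -/
def Fair (j : Fin I.m) (i : Fin (I.len j)) : Prop :=
  ∀ s, μ (I.prevEvent j i s) ≠ 0 →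
    ∫⁻ ω in I.prevEvent j i s, (ENNReal.ofReal (I.dynamicIndex j i s)
        - I.afterProbe j i (I.loss j · ω)) ∂μ
      = ENNReal.ofReal (I.wcost j i) * μ (I.prevEvent j i s)

variable {I}

lemma wcost_nonneg (j : Fin I.m) (i : Fin (I.len j)) : 0 ≤ I.wcost j i :=
  mul_nonneg (sub_nonneg.2 I.lam_mem.2) (I.cost_pos j i).le

/-- Used with `a` the index of a node, `z` what is left after probing it and `y` the best
alternative. The truncated difference is the saving due to the probe. -/
lemma min_max_eq_add_sub (y a z : ℝ≥0∞) : min y (max a z) = min y z + (min y a - z) := by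
  rcases le_total y z with h | h
  · rw [min_eq_left h, min_eq_left (h.trans (le_max_right _ _)),
      tsub_eq_zero_of_le ((min_le_left _ _).trans h), add_zero]
  · rw [min_eq_right h]
    rcases le_total a z with h' | h'
    · rw [max_eq_right h', min_eq_right h, tsub_eq_zero_of_le ((min_le_right _ _).trans h'),
        add_zero]
    · rw [max_eq_left h', add_tsub_cancel_of_le (le_min h h')]

lemma setLIntegral_surrogate_add {j : Fin I.m} {i : Fin (I.len j)} (A : Set Ω)
    {y C : Ω → ℝ≥0∞} (hy : Measurable y) (hC : Measurable C) :
    ∫⁻ ω in A, (min (y ω) (I.surrogate j i (I.loss j · ω)) + C ω) ∂μ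
      = ∫⁻ ω in A, (min (y ω) (I.afterProbe j i (I.loss j · ω)) + C ω) ∂μ
        + ∫⁻ ω in A, (min (y ω) (I.indexAt j i (I.loss j · ω))
            - I.afterProbe j i (I.loss j · ω)) ∂μ := by
  have hm : Measurable fun ω => min (y ω) (I.afterProbe j i (I.loss j · ω)) + C ω :=
    (hy.min (measurable_path j (I.afterProbe j i))).add hC
  rw [← lintegral_add_left hm]
  refine lintegral_congr fun ω => ?_
  rw [surrogate_eq_max, min_max_eq_add_sub, add_right_comm]

variable [IsProbabilityMeasure μ]

/-- The integrand looks only at the future, so its mean is the same on every past event with the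
same predecessor loss. `Fair` is silent on null events, which are therefore treated apart. -/
lemma Fair.setLIntegral_of_subset {j : Fin I.m} {i : Fin (I.len j)} (hi : I.Fair j i)
    {A : Set Ω} (hA : I.IsPast j i A) {s : ℝ} (hs : A ⊆ I.prevEvent j i s) :
    ∫⁻ ω in A, (ENNReal.ofReal (I.dynamicIndex j i s) - I.afterProbe j i (I.loss j · ω)) ∂μ
      = ENNReal.ofReal (I.wcost j i) * μ A := by
  by_cases h0 : μ (I.prevEvent j i s) = 0
  · have hA0 : μ A = 0 := measure_mono_null hs h0
    rw [setLIntegral_measure_zero _ _ hA0, hA0, mul_zero]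
  · obtain ⟨e, he⟩ := exists_setLIntegral_future_eq (μ := μ) j i
      (fun x => ENNReal.ofReal (I.dynamicIndex j i s) - I.afterProbe j i x)
      (fun x x' h => by rw [afterProbe_congr fun k hk => h k (Fin.le_def.1 hk)]) s
    have h1 := he (I.prevEvent j i s) (isPast_prevEvent j i s) fun ω hω => hω
    rw [hi s h0, ENNReal.mul_left_inj h0 (measure_ne_top _ _)] at h1
    rw [he A hA fun ω hω => hs hω, h1]

lemma Fair.setLIntegral_eq {j : Fin I.m} {i : Fin (I.len j)} (hi : I.Fair j i)
    {A : Set Ω} (hA : I.IsPast j i A) :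
    ∫⁻ ω in A, (I.indexAt j i (I.loss j · ω) - I.afterProbe j i (I.loss j · ω)) ∂μ
      = ENNReal.ofReal (I.wcost j i) * μ A := by
  obtain ⟨H, hH⟩ := (determined_path (I := I) j (I.prevLoss j i)).exists_setLIntegral_eq_sum
  rw [← setLIntegral_one, hH A hA.measurableSet, hH A hA.measurableSet, Finset.mul_sum]
  refine Finset.sum_congr rfl fun s _ => ?_
  set B := A ∩ (fun ω => I.prevLoss j i (I.loss j · ω)) ⁻¹' {s} with hBdef
  have hB : I.IsPast j i B := hA.inter fun ω ω' h hω => by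
    rw [Set.mem_preimage, Set.mem_singleton_iff] at hω ⊢
    rw [← hω]
    exact prevLoss_congr fun k hk => (h j k fun _ => by omega).symm
  have hs : B ⊆ I.prevEvent j i s := by
    rintro ω ⟨-, hω⟩
    rw [Set.mem_preimage, Set.mem_singleton_iff] at hω
    exact hω ▸ mem_prevEvent_prevLoss j i ω
  rw [setLIntegral_one, ← hi.setLIntegral_of_subset hB hs]
  refine setLIntegral_congr_fun hB.measurableSet fun ω hω => ?_
  have : I.prevLoss j i (I.loss j · ω) = s := hω.2
  simp only [indexAt, dif_pos i.2, this]

/-- Probing a node does not decrease the expected surrogate loss plus the paid cost. -/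
lemma Fair.setLIntegral_le {j : Fin I.m} {i : Fin (I.len j)} (hi : I.Fair j i) {A : Set Ω}
    (hA : I.IsPast j i A) {y C : Ω → ℝ≥0∞} (hy : Measurable y) (hC : Measurable C) :
    ∫⁻ ω in A, (min (y ω) (I.surrogate j i (I.loss j · ω)) + C ω) ∂μ
      ≤ ∫⁻ ω in A, (min (y ω) (I.afterProbe j i (I.loss j · ω)) + C ω
          + ENNReal.ofReal (I.wcost j i)) ∂μ := by
  rw [setLIntegral_surrogate_add A hy hC, lintegral_add_right _ measurable_const,
    setLIntegral_const, ← hi.setLIntegral_eq hA]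
  -- The bound `min y σ - Z ≤ σ - Z` is pointwise, so no independence of `y` from line `j` is
  -- needed.
  gcongr
  exact min_le_right _ _

/-- Probing a node whose index does not exceed the alternatives preserves the expected surrogate
loss plus the paid cost. -/
lemma Fair.setLIntegral_eq_of_index_le {j : Fin I.m} {i : Fin (I.len j)} (hi : I.Fair j i)
    {A : Set Ω} (hA : I.IsPast j i A) {y C : Ω → ℝ≥0∞} (hy : Measurable y) (hC : Measurable C)
    (hle : ∀ ω ∈ A, I.indexAt j i (I.loss j · ω) ≤ y ω) :
    ∫⁻ ω in A, (min (y ω) (I.surrogate j i (I.loss j · ω)) + C ω) ∂μ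
      = ∫⁻ ω in A, (min (y ω) (I.afterProbe j i (I.loss j · ω)) + C ω
          + ENNReal.ofReal (I.wcost j i)) ∂μ := by
  rw [setLIntegral_surrogate_add A hy hC, lintegral_add_right _ measurable_const,
    setLIntegral_const, ← hi.setLIntegral_eq hA]
  congr 1
  refine setLIntegral_congr_fun hA.measurableSet fun ω hω => ?_
  simp only [min_eq_right (hle ω hω)]

end Fair

/-! ### Stopping times of a line in terms of the losses they depend on. -/

section Stopping

variable {Ω : Type*} [MeasurableSpace Ω] {μ : Measure Ω} {I : MultiLineInstance Ω μ}

/-- The converse uses the finite support: there are finitely many prefixes, so every set of prefixes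
is measurable. -/
lemma measurableSet_lineFiltration_iff {j : Fin I.m} {k : Fin (I.len j)} {A : Set Ω} :
    MeasurableSet[I.lineFiltration j k] A ↔
      ∀ ω ω', (∀ l ≤ k, I.loss j l ω = I.loss j l ω') → ω ∈ A → ω' ∈ A := by
  constructor
  · intro hA
    let T : Ω → Set.Iic k → ℝ := fun ω l => I.loss j l ω
    have hle : I.lineFiltration j k ≤ MeasurableSpace.comap T ⊤ := by
      refine iSup₂_le fun l hl => ?_
      rintro S ⟨t, -, rfl⟩
      exact ⟨{x | x ⟨l, hl⟩ ∈ t}, trivial, rfl⟩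
    obtain ⟨t, -, rfl⟩ := hle A hA
    intro ω ω' h hω
    have : T ω' = T ω := funext fun l => (h l l.2).symm
    rw [Set.mem_preimage, this]
    exact hω
  · intro hA
    let T : Ω → Set.Iic k → I.support := fun ω l => ⟨I.loss j l ω, I.loss_mem j l ω⟩
    have hT : Measurable[I.lineFiltration j k] T := by
      refine @measurable_pi_lambda _ _ _ (I.lineFiltration j k) _ _ fun l => ?_
      have hl : Measurable[I.lineFiltration j k] (I.loss j l) :=
        (comap_measurable (I.loss j l)).mono
          (le_iSup₂_of_le (f := fun l (_ : l ≤ k) => MeasurableSpace.comap (I.loss j l) _)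
            l.1 l.2 le_rfl) le_rfl
      exact hl.subtype_mk
    have hAT : A = T ⁻¹' (T '' A) := by
      refine Set.Subset.antisymm (Set.subset_preimage_image T A) ?_
      rintro ω' ⟨ω, hω, h⟩
      exact hA ω ω' (fun l hl => congrArg Subtype.val (congrFun h ⟨l, hl⟩)) hω
    rw [hAT]
    exact hT (Set.Finite.measurableSet (Set.toFinite _))

/-- Going on beyond node `k` is decided by the losses up to `k`, so the fairness of node `k + 1`
applies on this event. -/
lemma isPast_lt_of_mem_lineStoppingTimes {j : Fin I.m} {i : Fin (I.len j)}
    {τ : Ω → Fin (I.len j)} (hτ : τ ∈ I.lineStoppingTimes j i) (k : ℕ) :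
    I.IsPast j (k + 1) {ω | k < (τ ω : ℕ)} := by
  intro ω ω' h hω
  rw [Set.mem_ofPred_eq] at hω ⊢
  by_contra hk
  have hkl : k < I.len j := hω.trans (τ ω).2
  have hm := hτ.1 ⟨k, hkl⟩
  rw [measurableSet_lineFiltration_iff] at hm
  have := hm ω' ω (fun l hl => (h j l fun _ => Nat.lt_succ_of_le (Fin.le_def.1 hl)).symm)
    (WithTop.coe_le_coe.2 (Fin.le_def.2 (not_lt.1 hk)))
  exact absurd (Fin.le_def.1 (WithTop.coe_le_coe.1 this)) (not_le.2 hω)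

lemma determined_of_mem_lineStoppingTimes {j : Fin I.m} {i : Fin (I.len j)}
    {τ : Ω → Fin (I.len j)} (hτ : τ ∈ I.lineStoppingTimes j i) : I.Determined τ := by
  have key : ∀ ω ω', (∀ j k, I.loss j k ω = I.loss j k ω') → τ ω ≤ τ ω' := by
    intro ω ω' h
    by_contra hlt
    have := isPast_lt_of_mem_lineStoppingTimes hτ (τ ω') ω ω' (fun j' k _ => h j' k)
      (Fin.lt_def.1 (not_le.1 hlt))
    exact lt_irrefl (τ ω' : ℕ) this
  exact fun ω ω' h => le_antisymm (key ω ω' h) (key ω' ω fun j k => (h j k).symm)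

end Stopping

/-! ### Recall minimum and cost of a segment of a line. -/

section Recall

variable {Ω : Type*} [MeasurableSpace Ω] {μ : Measure Ω} (I : MultiLineInstance Ω μ)

/-- The minimum weighted loss of the nodes `i, …, k` of a line. -/
noncomputable def recallMin (j : Fin I.m) (i k : ℕ) (x : Fin (I.len j) → ℝ) : ℝ≥0∞ :=
  ⨅ l : Fin (I.len j), ⨅ _ : i ≤ (l : ℕ) ∧ (l : ℕ) ≤ k, ENNReal.ofReal (I.lam * x l)

/-- The weighted cost of the nodes `i, …, k` of a line. -/
noncomputable def segmentCost (j : Fin I.m) (i k : ℕ) : ℝ≥0∞ :=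
  ∑ l ∈ Finset.univ.filter fun l : Fin (I.len j) => i ≤ (l : ℕ) ∧ (l : ℕ) ≤ k,
    ENNReal.ofReal (I.wcost j l)

variable {I}

lemma recallMin_self (j : Fin I.m) (i : Fin (I.len j)) (x : Fin (I.len j) → ℝ) :
    I.recallMin j i i x = ENNReal.ofReal (I.lam * x i) := by
  refine le_antisymm (iInf₂_le i ⟨le_rfl, le_rfl⟩) (le_iInf₂ fun l hl => ?_)
  rw [Fin.ext (le_antisymm hl.2 hl.1)]

lemma recallMin_succ (j : Fin I.m) {i k : ℕ} (hik : i ≤ k) (hk : k + 1 < I.len j)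
    (x : Fin (I.len j) → ℝ) :
    I.recallMin j i (k + 1) x
      = min (I.recallMin j i k x) (ENNReal.ofReal (I.lam * x ⟨k + 1, hk⟩)) := by
  refine le_antisymm (le_min (le_iInf₂ fun l hl => iInf₂_le l ⟨hl.1, by omega⟩)
    (iInf₂_le (⟨k + 1, hk⟩ : Fin (I.len j)) ⟨by simp; omega, le_rfl⟩)) (le_iInf₂ fun l hl => ?_)
  rcases Nat.lt_or_ge k l with h | h
  · have : l = ⟨k + 1, hk⟩ := Fin.ext (le_antisymm hl.2 h)
    exact this ▸ min_le_right _ _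
  · exact (min_le_left _ _).trans (iInf₂_le l ⟨hl.1, h⟩)

lemma recallMin_congr {j : Fin I.m} {i k : ℕ} {x x' : Fin (I.len j) → ℝ}
    (h : ∀ l : Fin (I.len j), (l : ℕ) ≤ k → x l = x' l) :
    I.recallMin j i k x = I.recallMin j i k x' :=
  iInf_congr fun l => iInf_congr fun hl => by rw [h l hl.2]

lemma segmentCost_self (j : Fin I.m) (i : Fin (I.len j)) :
    I.segmentCost j i i = ENNReal.ofReal (I.wcost j i) := by
  have : (Finset.univ.filter fun l : Fin (I.len j) => (i : ℕ) ≤ l ∧ (l : ℕ) ≤ i) = {i} := by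
    ext l
    simp only [Finset.mem_filter, Finset.mem_univ, true_and, Finset.mem_singleton, Fin.ext_iff]
    omega
  rw [segmentCost, this, Finset.sum_singleton]

lemma segmentCost_succ (j : Fin I.m) {i k : ℕ} (hik : i ≤ k) (hk : k + 1 < I.len j) :
    I.segmentCost j i (k + 1)
      = I.segmentCost j i k + ENNReal.ofReal (I.wcost j ⟨k + 1, hk⟩) := by
  have : (Finset.univ.filter fun l : Fin (I.len j) => i ≤ (l : ℕ) ∧ (l : ℕ) ≤ k + 1)
      = insert ⟨k + 1, hk⟩
        (Finset.univ.filter fun l : Fin (I.len j) => i ≤ (l : ℕ) ∧ (l : ℕ) ≤ k) := by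
    ext l
    simp only [Finset.mem_filter, Finset.mem_univ, true_and, Finset.mem_insert, Fin.ext_iff]
    omega
  rw [segmentCost, this, Finset.sum_insert (by simp), add_comm, segmentCost]

lemma segmentCost_ne_top (j : Fin I.m) (i k : ℕ) : I.segmentCost j i k ≠ ∞ :=
  ENNReal.sum_ne_top.2 fun _ _ => ENNReal.ofReal_ne_top

lemma recallMin_eq_ofReal {j : Fin I.m} {i k : Fin (I.len j)} (hik : i ≤ k)
    (x : Fin (I.len j) → ℝ) :
    I.recallMin j i k x = ENNReal.ofReal (⨅ l : Set.Icc i k, I.lam * x l) := by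
  have : Nonempty (Set.Icc i k) := ⟨⟨i, le_rfl, hik⟩⟩
  obtain ⟨l₀, hl₀⟩ := exists_eq_ciInf_of_finite (f := fun l : Set.Icc i k => I.lam * x l)
  refine le_antisymm ?_ (le_iInf₂ fun l hl => ENNReal.ofReal_le_ofReal ?_)
  · rw [← hl₀]
    exact iInf₂_le l₀.1 l₀.2
  · exact ciInf_le (Set.finite_range fun l : Set.Icc i k => I.lam * x l).bddBelow
      (⟨l, hl⟩ : Set.Icc i k)

lemma segmentCost_eq_ofReal (j : Fin I.m) (i k : Fin (I.len j)) :
    I.segmentCost j i k = ENNReal.ofReal (∑ l ∈ Finset.Icc i k, I.wcost j l) := by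
  rw [ENNReal.ofReal_sum_of_nonneg fun l _ => wcost_nonneg j l, segmentCost]
  refine Finset.sum_congr ?_ fun _ _ => rfl
  ext l
  simp

/-- Since `(σ - R)₊ = σ - min σ R`, maximizing the gain amounts to minimizing a nonnegative loss
with outside option `σ`. -/
lemma toReal_min_recallMin_add {j : Fin I.m} {i k : Fin (I.len j)} (hik : i ≤ k) {ω : Ω} {σ : ℝ}
    (hσ : 0 ≤ σ) :
    (min (ENNReal.ofReal σ) (I.recallMin j i k (I.loss j · ω)) + I.segmentCost j i k).toReal
      = σ - (max (σ - ⨅ l : Set.Icc i k, I.lam * I.loss j l ω) 0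
        - ∑ l ∈ Finset.Icc i k, (1 - I.lam) * I.cost j l) := by
  have hR : 0 ≤ ⨅ l : Set.Icc i k, I.lam * I.loss j l ω := Real.iInf_nonneg fun l =>
    mul_nonneg I.lam_mem.1 (I.support_pos _ (I.loss_mem j l ω)).le
  have hC : 0 ≤ ∑ l ∈ Finset.Icc i k, I.wcost j l :=
    Finset.sum_nonneg fun l _ => wcost_nonneg j l
  rw [recallMin_eq_ofReal hik, segmentCost_eq_ofReal, ← ENNReal.ofReal_min,
    ← ENNReal.ofReal_add (le_min hσ hR) hC,
    ENNReal.toReal_ofReal (add_nonneg (le_min hσ hR) hC)]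
  simp only [wcost]
  rcases le_total σ (⨅ l : Set.Icc i k, I.lam * I.loss j l ω) with h | h
  · rw [min_eq_left h, max_eq_right (sub_nonpos.2 h)]; ring
  · rw [min_eq_right h, max_eq_left (sub_nonneg.2 h)]; ring

end Recall

/-! ### Optimal stopping on one line with an outside option. -/

section Gain

variable {Ω : Type*} [MeasurableSpace Ω] {μ : Measure Ω} {I : MultiLineInstance Ω μ}

lemma integral_const_sub_toReal {ν : Measure Ω} [IsProbabilityMeasure ν] (σ : ℝ) {g : Ω → ℝ≥0∞}
    (hg : Measurable g) {M : ℝ≥0∞} (hM : M ≠ ∞) (hgM : ∀ ω, g ω ≤ M) :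
    ∫ ω, (σ - (g ω).toReal) ∂ν = σ - (∫⁻ ω, g ω ∂ν).toReal := by
  have hfin : ∫⁻ ω, g ω ∂ν ≠ ∞ := by
    refine ((lintegral_mono hgM).trans_lt ?_).ne
    simpa using hM.lt_top
  rw [integral_sub (integrable_const σ) (integrable_toReal_of_lintegral_ne_top hg.aemeasurable hfin),
    integral_toReal hg.aemeasurable (Filter.Eventually.of_forall fun ω => (hgM ω).trans_lt hM.lt_top)]
  simp

/-- The surrogate process of line `j` started at node `i` with outside option `σ`: the expected
loss when continuing optimally after having probed `i, …, k`. -/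
noncomputable def level (I : MultiLineInstance Ω μ) (j : Fin I.m) (i : ℕ) (σ : ℝ≥0∞) (k : ℕ)
    (x : Fin (I.len j) → ℝ) : ℝ≥0∞ :=
  min (min σ (I.recallMin j i k x)) (I.surrogate j (k + 1) x) + I.segmentCost j i k

lemma level_self (j : Fin I.m) (i : Fin (I.len j)) (σ : ℝ≥0∞) (x : Fin (I.len j) → ℝ) :
    I.level j i σ i x = min σ (I.afterProbe j i x) + ENNReal.ofReal (I.wcost j i) := by
  rw [level, recallMin_self, segmentCost_self, min_assoc, afterProbe]

lemma level_succ (j : Fin I.m) {i k : ℕ} (hik : i ≤ k) (hk : k + 1 < I.len j) (σ : ℝ≥0∞)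
    (x : Fin (I.len j) → ℝ) :
    I.level j i σ (k + 1) x = min (min σ (I.recallMin j i k x)) (I.afterProbe j ⟨k + 1, hk⟩ x)
      + I.segmentCost j i k + ENNReal.ofReal (I.wcost j ⟨k + 1, hk⟩) := by
  rw [level, recallMin_succ j hik hk, segmentCost_succ j hik hk, ← add_assoc, afterProbe,
    ← min_assoc, ← min_assoc]

/-- The expected improvement over the outside option `σ` by the surrogate loss after probing `i`. -/
noncomputable def improvement (I : MultiLineInstance Ω μ) (j : Fin I.m) (i : Fin (I.len j))
    (s σ : ℝ) : ℝ :=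
  ∫ ω, max (σ - (I.afterProbe j i (I.loss j · ω)).toReal) 0 ∂(μ[|I.prevEvent j i s])

lemma afterProbe_ne_top (j : Fin I.m) (i : Fin (I.len j)) (x : Fin (I.len j) → ℝ) :
    I.afterProbe j i x ≠ ∞ :=
  ((min_le_left _ _).trans_lt ENNReal.ofReal_lt_top).ne

lemma integrable_improvement (j : Fin I.m) (i : Fin (I.len j)) (s σ : ℝ) :
    Integrable (fun ω => max (σ - (I.afterProbe j i (I.loss j · ω)).toReal) 0)
      (μ[|I.prevEvent j i s]) := by
  refine Integrable.of_bound (C := |σ|)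
    (measurable_path j fun x => max (σ - (I.afterProbe j i x).toReal) 0).aestronglyMeasurable
    (Filter.Eventually.of_forall fun ω => ?_)
  rw [Real.norm_of_nonneg (le_max_right _ _)]
  exact max_le ((sub_le_self _ ENNReal.toReal_nonneg).trans (le_abs_self _)) (abs_nonneg _)

lemma improvement_zero (j : Fin I.m) (i : Fin (I.len j)) (s : ℝ) : I.improvement j i s 0 = 0 := by
  have : ∀ ω, max (0 - (I.afterProbe j i (I.loss j · ω)).toReal) 0 = 0 := fun ω =>
    max_eq_right (by simp)
  simp only [improvement, this, integral_zero]

/-- Stop at the first node after which the next index is at least the value in hand; it exists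
because the index past the end is `∞`. The first property keeps `level` constant in mean up to `τ`,
the second removes the surrogate from `level` at `τ`. -/
lemma exists_lineStoppingTime_index (j : Fin I.m) (i : Fin (I.len j)) (σ : ℝ≥0∞) :
    ∃ τ ∈ I.lineStoppingTimes j i,
      (∀ ω (k : ℕ), i ≤ k → k < τ ω → I.indexAt j (k + 1) (I.loss j · ω)
        ≤ min σ (I.recallMin j i k (I.loss j · ω))) ∧
      ∀ ω, min σ (I.recallMin j i (τ ω) (I.loss j · ω))
        ≤ I.indexAt j (τ ω + 1) (I.loss j · ω) := by
  set P : Ω → Fin (I.len j) → Prop := fun ω k => i ≤ k ∧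
    min σ (I.recallMin j i k (I.loss j · ω)) ≤ I.indexAt j (k + 1) (I.loss j · ω) with hP
  have hne : ∀ ω, ∃ k, P ω k := fun ω => by
    have hi := i.2
    refine ⟨⟨I.len j - 1, by omega⟩, Fin.le_def.2 (by simp; omega), ?_⟩
    have : ¬ (I.len j - 1 + 1 < I.len j) := by omega
    simp only [indexAt, dif_neg this, le_top]
  have hmin : ∀ ω, ∃ k, P ω k ∧ ∀ l, P ω l → k ≤ l := fun ω => by
    obtain ⟨k, hk, h⟩ := wellFounded_lt.has_min {k | P ω k} (hne ω)
    exact ⟨k, hk, fun l hl => not_lt.1 (h l hl)⟩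
  choose τ hτ hτmin using hmin
  have hPc : ∀ ω ω' k, (∀ l ≤ k, I.loss j l ω = I.loss j l ω') → P ω k → P ω' k := by
    intro ω ω' k h hk
    refine ⟨hk.1, ?_⟩
    rw [recallMin_congr (x' := (I.loss j · ω)) fun l hl => (h l (Fin.le_def.2 hl)).symm,
      indexAt_congr (x' := (I.loss j · ω))
        fun l hl => (h l (Fin.le_def.2 (Nat.succ_le_succ_iff.1 hl.le))).symm]
    exact hk.2
  refine ⟨τ, ⟨fun k => ?_, fun ω => (hτ ω).1⟩, fun ω k hik hk => ?_, fun ω => (hτ ω).2⟩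
  · rw [measurableSet_lineFiltration_iff]
    intro ω ω' h hω
    have hω : τ ω ≤ k := WithTop.coe_le_coe.1 hω
    exact WithTop.coe_le_coe.2 ((hτmin ω' _ (hPc ω ω' (τ ω) (fun l hl => h l (hl.trans hω))
      (hτ ω))).trans hω)
  · by_contra hcon
    have := hτmin ω ⟨k, hk.trans (τ ω).2⟩ ⟨Fin.le_def.2 hik, (not_le.1 hcon).le⟩
    exact absurd (Fin.le_def.1 this) (not_le.2 hk)

variable [IsProbabilityMeasure μ]

/-- Nothing changes where `τ ≤ k`; elsewhere the step is a probe of node `k + 1`, made on a past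
event. -/
lemma setLIntegral_level_le_succ {j : Fin I.m} {i : Fin (I.len j)} {τ : Ω → Fin (I.len j)}
    (hτ : τ ∈ I.lineStoppingTimes j i) {A : Set Ω} (hA : I.IsPast j i A) (σ : ℝ≥0∞) {k : ℕ}
    (hik : (i : ℕ) ≤ k) (hk : k + 1 < I.len j) (hfair : I.Fair j ⟨k + 1, hk⟩) :
    ∫⁻ ω in A, I.level j i σ (min (τ ω) k) (I.loss j · ω) ∂μ
      ≤ ∫⁻ ω in A, I.level j i σ (min (τ ω) (k + 1)) (I.loss j · ω) ∂μ ∧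
    ((∀ ω, k < τ ω → I.indexAt j (k + 1) (I.loss j · ω)
        ≤ min σ (I.recallMin j i k (I.loss j · ω))) →
      ∫⁻ ω in A, I.level j i σ (min (τ ω) k) (I.loss j · ω) ∂μ
        = ∫⁻ ω in A, I.level j i σ (min (τ ω) (k + 1)) (I.loss j · ω) ∂μ) := by
  set B : Set Ω := {ω | k < (τ ω : ℕ)} with hB
  have hBp : I.IsPast j (k + 1) B := isPast_lt_of_mem_lineStoppingTimes hτ k
  have hAB : I.IsPast j (⟨k + 1, hk⟩ : Fin (I.len j)) (A ∩ B) := (hA.mono (by simp; omega)).inter hBp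
  have h1 : ∫⁻ ω in A \ B, I.level j i σ (min (τ ω) k) (I.loss j · ω) ∂μ
      = ∫⁻ ω in A \ B, I.level j i σ (min (τ ω) (k + 1)) (I.loss j · ω) ∂μ := by
    refine setLIntegral_congr_fun (hA.measurableSet.diff hBp.measurableSet) fun ω hω => ?_
    have : (τ ω : ℕ) ≤ k := not_lt.1 hω.2
    simp only [min_eq_left this, min_eq_left (Nat.le_succ_of_le this)]
  have h2 : ∫⁻ ω in A ∩ B, I.level j i σ (min (τ ω) k) (I.loss j · ω) ∂μ
      = ∫⁻ ω in A ∩ B, (min (min σ (I.recallMin j i k (I.loss j · ω)))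
          (I.surrogate j (⟨k + 1, hk⟩ : Fin (I.len j)) (I.loss j · ω)) + I.segmentCost j i k) ∂μ := by
    refine setLIntegral_congr_fun hAB.measurableSet fun ω hω => ?_
    have : k < (τ ω : ℕ) := hω.2
    simp only [min_eq_right this.le, level]
  have h3 : ∫⁻ ω in A ∩ B, I.level j i σ (min (τ ω) (k + 1)) (I.loss j · ω) ∂μ
      = ∫⁻ ω in A ∩ B, (min (min σ (I.recallMin j i k (I.loss j · ω)))
          (I.afterProbe j ⟨k + 1, hk⟩ (I.loss j · ω)) + I.segmentCost j i k
          + ENNReal.ofReal (I.wcost j ⟨k + 1, hk⟩)) ∂μ := by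
    refine setLIntegral_congr_fun hAB.measurableSet fun ω hω => ?_
    have : k < (τ ω : ℕ) := hω.2
    simp only [min_eq_right (Nat.succ_le_of_lt this), level_succ j hik hk]
  have hy : Measurable fun ω => min σ (I.recallMin j i k (I.loss j · ω)) :=
    measurable_path j fun x => min σ (I.recallMin j i k x)
  rw [← lintegral_inter_add_sdiff _ A hBp.measurableSet,
    ← lintegral_inter_add_sdiff (fun ω => I.level j i σ (min (τ ω) (k + 1)) (I.loss j · ω)) A
      hBp.measurableSet, h1, h2, h3]
  refine ⟨?_, fun hle => ?_⟩
  · gcongr 1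
    exact hfair.setLIntegral_le hAB hy measurable_const
  · congr 1
    exact hfair.setLIntegral_eq_of_index_le hAB hy measurable_const fun ω hω => hle ω hω.2

lemma setLIntegral_level_le {j : Fin I.m} {i : Fin (I.len j)} {τ : Ω → Fin (I.len j)}
    (hτ : τ ∈ I.lineStoppingTimes j i) {A : Set Ω} (hA : I.IsPast j i A) (σ : ℝ≥0∞)
    (hfair : ∀ k, i < k → I.Fair j k) :
    ∫⁻ ω in A, I.level j i σ i (I.loss j · ω) ∂μ
      ≤ ∫⁻ ω in A, I.level j i σ (τ ω) (I.loss j · ω) ∂μ ∧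
    ((∀ ω (k : ℕ), i ≤ k → k < τ ω → I.indexAt j (k + 1) (I.loss j · ω)
        ≤ min σ (I.recallMin j i k (I.loss j · ω))) →
      ∫⁻ ω in A, I.level j i σ i (I.loss j · ω) ∂μ
        = ∫⁻ ω in A, I.level j i σ (τ ω) (I.loss j · ω) ∂μ) := by
  have hstep : ∀ k : ℕ, (i : ℕ) ≤ k → k < I.len j →
      ∫⁻ ω in A, I.level j i σ i (I.loss j · ω) ∂μ
        ≤ ∫⁻ ω in A, I.level j i σ (min (τ ω) k) (I.loss j · ω) ∂μ ∧
      ((∀ ω (k : ℕ), i ≤ k → k < τ ω → I.indexAt j (k + 1) (I.loss j · ω)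
          ≤ min σ (I.recallMin j i k (I.loss j · ω))) →
        ∫⁻ ω in A, I.level j i σ i (I.loss j · ω) ∂μ
          = ∫⁻ ω in A, I.level j i σ (min (τ ω) k) (I.loss j · ω) ∂μ) := by
    intro k hik
    induction k, hik using Nat.le_induction with
    | base =>
      intro _
      have h : ∀ ω, min (τ ω : ℕ) i = i := fun ω => min_eq_right (Fin.le_def.1 (hτ.2 ω))
      simp only [h, le_refl, implies_true, and_self]
    | succ k hik ih =>
      intro hk
      have h1 := ih (by omega)
      have h2 := setLIntegral_level_le_succ hτ hA σ hik hk
        (hfair _ (Fin.lt_def.2 (Nat.lt_succ_of_le hik)))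
      exact ⟨h1.1.trans h2.1, fun h => (h1.2 h).trans (h2.2 fun ω hω => h ω k hik hω)⟩
  have hlast : ∀ ω, min (τ ω : ℕ) (I.len j - 1) = τ ω := fun ω =>
    min_eq_left (Nat.le_sub_one_of_lt (τ ω).2)
  have hi := i.2
  have := hstep (I.len j - 1) (by omega) (by omega)
  simpa only [hlast] using this

lemma gain_eq {j : Fin I.m} {i : Fin (I.len j)} {s σ : ℝ} (hσ : 0 ≤ σ)
    (hs : μ (I.prevEvent j i s) ≠ 0) {τ : Ω → Fin (I.len j)} (hτ : τ ∈ I.lineStoppingTimes j i) :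
    I.gain j i s σ τ = σ - (∫⁻ ω, (min (ENNReal.ofReal σ)
      (I.recallMin j i (τ ω) (I.loss j · ω)) + I.segmentCost j i (τ ω))
        ∂(μ[|I.prevEvent j i s])).toReal := by
  have := cond_isProbabilityMeasure (μ := μ) hs
  have hdet : I.Determined fun ω => min (ENNReal.ofReal σ)
      (I.recallMin j i (τ ω) (I.loss j · ω)) + I.segmentCost j i (τ ω) := fun ω ω' h => by
    simp only [determined_of_mem_lineStoppingTimes hτ ω ω' h, h]
  rw [← integral_const_sub_toReal σ hdet.measurable
    (M := ENNReal.ofReal σ + ∑ k : Fin (I.len j), I.segmentCost j i k) ?_ ?_]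
  · refine integral_congr_ae (Filter.Eventually.of_forall fun ω => ?_)
    simp only [toReal_min_recallMin_add (hτ.2 ω) hσ, sub_sub_cancel]
  · exact ENNReal.add_ne_top.2 ⟨ENNReal.ofReal_ne_top,
      ENNReal.sum_ne_top.2 fun k _ => segmentCost_ne_top j i k⟩
  · intro ω
    gcongr
    · exact min_le_left _ _
    · exact Finset.single_le_sum (f := fun k : Fin (I.len j) => I.segmentCost j i k)
        (fun _ _ => zero_le) (Finset.mem_univ (τ ω))

lemma improvement_sub_eq {j : Fin I.m} {i : Fin (I.len j)} {s σ : ℝ} (hσ : 0 ≤ σ)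
    (hs : μ (I.prevEvent j i s) ≠ 0) :
    I.improvement j i s σ - I.wcost j i
      = σ - (∫⁻ ω, I.level j i (ENNReal.ofReal σ) i (I.loss j · ω)
          ∂(μ[|I.prevEvent j i s])).toReal := by
  have := cond_isProbabilityMeasure (μ := μ) hs
  rw [← integral_const_sub_toReal σ (measurable_path j (I.level j i (ENNReal.ofReal σ) i))
    (M := ENNReal.ofReal σ + ENNReal.ofReal (I.wcost j i)) (by simp) ?_]
  swap
  · intro ω
    rw [level_self]
    gcongr
    exact min_le_left _ _
  have h : ∀ ω, σ - (I.level j i (ENNReal.ofReal σ) i (I.loss j · ω)).toReal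
      = max (σ - (I.afterProbe j i (I.loss j · ω)).toReal) 0 - I.wcost j i := by
    intro ω
    rw [level_self, ENNReal.toReal_add
      ((min_le_left _ _).trans_lt ENNReal.ofReal_lt_top).ne ENNReal.ofReal_ne_top,
      ENNReal.toReal_ofReal (wcost_nonneg j i),
      ENNReal.toReal_min ENNReal.ofReal_ne_top (afterProbe_ne_top j i _),
      ENNReal.toReal_ofReal hσ]
    rcases le_total σ (I.afterProbe j i (I.loss j · ω)).toReal with h | h
    · rw [min_eq_left h, max_eq_right (sub_nonpos.2 h)]; ring
    · rw [min_eq_right h, max_eq_left (sub_nonneg.2 h)]; ring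
  simp only [h]
  rw [integral_sub _ (integrable_const _)]
  · simp [improvement]
  · refine Integrable.of_bound (C := σ)
      (measurable_path j fun x => max (σ - (I.afterProbe j i x).toReal) 0).aestronglyMeasurable
      (Filter.Eventually.of_forall fun ω => ?_)
    rw [Real.norm_of_nonneg (le_max_right _ _)]
    exact max_le (sub_le_self _ ENNReal.toReal_nonneg) hσ

/-- Optional stopping: the loss when stopping at `τ` dominates `level` at `τ`, whose mean is at
least that of `level` at `i`. Both are equalities for the rule of `exists_lineStoppingTime_index`.
Only later nodes must be fair, so there is no circularity. -/
lemma isGreatest_gain {j : Fin I.m} {i : Fin (I.len j)} {s σ : ℝ} (hσ : 0 ≤ σ)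
    (hs : μ (I.prevEvent j i s) ≠ 0) (hfair : ∀ k, i < k → I.Fair j k) :
    IsGreatest (I.gain j i s σ '' I.lineStoppingTimes j i)
      (I.improvement j i s σ - I.wcost j i) := by
  have := cond_isProbabilityMeasure (μ := μ) hs
  have hcond : ∀ f : Ω → ℝ≥0∞, ∫⁻ ω, f ω ∂(μ[|I.prevEvent j i s])
      = (μ (I.prevEvent j i s))⁻¹ * ∫⁻ ω in I.prevEvent j i s, f ω ∂μ := fun f => by
    rw [ProbabilityTheory.cond, lintegral_smul_measure, smul_eq_mul]
  have hpast := isPast_prevEvent j i s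
  rw [improvement_sub_eq hσ hs]
  constructor
  · obtain ⟨τ, hτ, h1, h2⟩ := exists_lineStoppingTime_index j i (ENNReal.ofReal σ)
    refine ⟨τ, hτ, ?_⟩
    rw [gain_eq hσ hs hτ, hcond, hcond, (setLIntegral_level_le hτ hpast _ hfair).2 h1]
    congr 4
    funext ω
    rw [level, min_eq_left ((h2 ω).trans (indexAt_le_surrogate _ _ _))]
  · rintro _ ⟨τ, hτ, rfl⟩
    rw [gain_eq hσ hs hτ]
    have hle : ∫⁻ ω, I.level j i (ENNReal.ofReal σ) i (I.loss j · ω) ∂(μ[|I.prevEvent j i s])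
        ≤ ∫⁻ ω, (min (ENNReal.ofReal σ) (I.recallMin j i (τ ω) (I.loss j · ω))
          + I.segmentCost j i (τ ω)) ∂(μ[|I.prevEvent j i s]) := by
      rw [hcond, hcond]
      gcongr 1
      refine (setLIntegral_level_le hτ hpast _ hfair).1.trans (lintegral_mono fun ω => ?_)
      exact add_le_add_left (min_le_left _ _) _
    refine sub_le_sub_left (ENNReal.toReal_mono ?_ hle) σ
    refine ((lintegral_mono (g := fun _ => ENNReal.ofReal σ
      + ∑ k : Fin (I.len j), I.segmentCost j i k) fun ω => ?_).trans_lt ?_).ne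
    · exact add_le_add (min_le_left _ _) (Finset.single_le_sum
        (f := fun k : Fin (I.len j) => I.segmentCost j i k)
        (fun _ _ => zero_le) (Finset.mem_univ (τ ω)))
    · rw [lintegral_const, measure_univ, mul_one]
      exact ENNReal.add_lt_top.2 ⟨ENNReal.ofReal_lt_top,
        ENNReal.sum_lt_top.2 fun k _ => (segmentCost_ne_top j i k).lt_top⟩

end Gain

/-! ### Existence of the index and fairness of every node. -/

section Index

variable {Ω : Type*} [MeasurableSpace Ω] {μ : Measure Ω} [IsProbabilityMeasure μ]
  {I : MultiLineInstance Ω μ}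

lemma continuous_improvement (j : Fin I.m) (i : Fin (I.len j)) {s : ℝ}
    (hs : μ (I.prevEvent j i s) ≠ 0) : Continuous (I.improvement j i s) := by
  have := cond_isProbabilityMeasure (μ := μ) hs
  refine LipschitzWith.continuous (K := 1) (LipschitzWith.of_dist_le_mul fun a b => ?_)
  rw [Real.dist_eq, Real.dist_eq, improvement, improvement,
    ← integral_sub (integrable_improvement j i s a) (integrable_improvement j i s b)]
  have hle : ∀ ω, ‖max (a - (I.afterProbe j i (I.loss j · ω)).toReal) 0
      - max (b - (I.afterProbe j i (I.loss j · ω)).toReal) 0‖ ≤ |a - b| := fun ω => by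
    refine (abs_max_sub_max_le_abs _ _ _).trans ?_
    rw [sub_sub_sub_cancel_right]
  simpa using norm_integral_le_of_norm_le_const (μ := μ[|I.prevEvent j i s])
    (Filter.Eventually.of_forall hle)

lemma exists_wcost_le_improvement (j : Fin I.m) (i : Fin (I.len j)) {s : ℝ}
    (hs : μ (I.prevEvent j i s) ≠ 0) : ∃ σ, 0 ≤ σ ∧ I.wcost j i ≤ I.improvement j i s σ := by
  have := cond_isProbabilityMeasure (μ := μ) hs
  -- The sum of the support bounds every loss, hence every `afterProbe` because `λ ≤ 1`; the level
  -- `b + wcost` then improves by at least the cost in every scenario.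
  set b := ∑ v ∈ I.support, v with hb
  have hb0 : 0 ≤ b := Finset.sum_nonneg fun v hv => (I.support_pos v hv).le
  refine ⟨b + I.wcost j i, add_nonneg hb0 (wcost_nonneg j i), ?_⟩
  have h : ∫ _, I.wcost j i ∂(μ[|I.prevEvent j i s]) = I.wcost j i := by simp
  rw [← h]
  refine integral_mono (integrable_const _) (integrable_improvement j i s _) fun ω => ?_
  refine le_max_of_le_left (le_sub_iff_add_le.2 ?_)
  rw [h, add_comm]
  gcongr
  have hv := I.loss_mem j i ω
  have hpos := I.support_pos _ hv
  calc (I.afterProbe j i (I.loss j · ω)).toReal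
      ≤ (ENNReal.ofReal (I.lam * I.loss j i ω)).toReal :=
        ENNReal.toReal_mono ENNReal.ofReal_ne_top (min_le_left _ _)
    _ = I.lam * I.loss j i ω := ENNReal.toReal_ofReal (mul_nonneg I.lam_mem.1 hpos.le)
    _ ≤ I.loss j i ω := mul_le_of_le_one_left hpos.le I.lam_mem.2
    _ ≤ b := Finset.single_le_sum (f := fun v => v) (fun v hv => (I.support_pos v hv).le) hv

/-- By `isGreatest_gain` the indifference levels are where the continuous improvement equals the
cost. It vanishes at `0` and eventually reaches the cost, so the set is nonempty; being closed, it
contains its infimum. -/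
lemma isLeast_dynamicIndex_of_fair {j : Fin I.m} {i : Fin (I.len j)}
    (hfair : ∀ k, i < k → I.Fair j k) {s : ℝ} (hs : μ (I.prevEvent j i s) ≠ 0) :
    IsLeast (I.indexSolutions j i s) (I.dynamicIndex j i s) ∧
      I.improvement j i s (I.dynamicIndex j i s) = I.wcost j i := by
  have hset : I.indexSolutions j i s
      = Set.Ici 0 ∩ I.improvement j i s ⁻¹' {I.wcost j i} := by
    ext σ
    simp only [indexSolutions, Set.mem_ofPred_eq, Set.mem_inter_iff, Set.mem_Ici,
      Set.mem_preimage, Set.mem_singleton_iff, and_congr_right_iff]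
    intro hσ
    have h := isGreatest_gain hσ hs hfair
    refine ⟨fun h0 => sub_eq_zero.1 (h.unique h0), fun h0 => ?_⟩
    rwa [h0, sub_self] at h
  have hcont := continuous_improvement j i hs
  have hclosed : IsClosed (I.indexSolutions j i s) := by
    rw [hset]
    exact isClosed_Ici.inter (isClosed_singleton.preimage hcont)
  have hne : (I.indexSolutions j i s).Nonempty := by
    obtain ⟨b, hb, hbw⟩ := exists_wcost_le_improvement j i hs
    obtain ⟨σ, hσ, h⟩ := intermediate_value_Icc hb hcont.continuousOn
      ⟨(improvement_zero j i s).trans_le (wcost_nonneg j i), hbw⟩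
    exact hset ▸ ⟨σ, hσ.1, h⟩
  have hleast := hclosed.isLeast_csInf hne ⟨0, fun σ hσ => hσ.1⟩
  refine ⟨hleast, ?_⟩
  have := hleast.1
  exact (hset.subset this).2

lemma fair_of_improvement_eq {j : Fin I.m} {i : Fin (I.len j)}
    (h : ∀ s, μ (I.prevEvent j i s) ≠ 0 →
      I.improvement j i s (I.dynamicIndex j i s) = I.wcost j i) : I.Fair j i := by
  intro s hs
  rw [← h s hs, improvement, ofReal_integral_eq_lintegral_ofReal (integrable_improvement j i s _)
    (Filter.Eventually.of_forall fun ω => le_max_right _ _), ProbabilityTheory.cond,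
    lintegral_smul_measure, smul_eq_mul, mul_comm, ← mul_assoc,
    ENNReal.mul_inv_cancel hs (measure_ne_top _ _), one_mul]
  refine lintegral_congr fun ω => ?_
  rw [ENNReal.ofReal_max, ENNReal.ofReal_zero, max_eq_left zero_le,
    ENNReal.ofReal_sub _ ENNReal.toReal_nonneg, ENNReal.ofReal_toReal (afterProbe_ne_top j i _)]

/-- Backward induction along the line: fairness of the later nodes identifies the index of `i` with
a solution of the equation that says `i` is fair. -/
lemma fair (j : Fin I.m) (i : Fin (I.len j)) : I.Fair j i := by
  induction hd : I.len j - i using Nat.strong_induction_on generalizing i with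
  | _ d ih =>
    refine fair_of_improvement_eq fun s hs => (isLeast_dynamicIndex_of_fair (fun k hk => ?_) hs).2
    exact ih _ (by have := Fin.lt_def.1 hk; omega) k rfl

/-- The dynamic index is the smallest indifference level. -/
theorem isLeast_dynamicIndex (j : Fin I.m) (i : Fin (I.len j)) {s : ℝ}
    (hs : μ (I.prevEvent j i s) ≠ 0) :
    IsLeast (I.indexSolutions j i s) (I.dynamicIndex j i s) :=
  (isLeast_dynamicIndex_of_fair (fun k _ => fair j k) hs).1

end Index

/-! ### Reachable histories. -/

section Histories

variable {Ω : Type*} [MeasurableSpace Ω] {μ : Measure Ω} {I : MultiLineInstance Ω μ}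

lemma probed_cons (h : I.History) (j : Fin I.m) (r : ℝ) (k : Fin I.m) :
    I.probed ((j, r) :: h) k = I.probed h k + if j = k then 1 else 0 := by
  simp [probed, List.count_cons]

lemma bestLoss_cons (h : I.History) (j : Fin I.m) (r : ℝ) :
    I.bestLoss ((j, r) :: h) = min (ENNReal.ofReal (I.lam * r)) (I.bestLoss h) := by
  simp [bestLoss, iInf_or, iInf_inf_eq]

lemma paidCost_nonneg (h : I.History) : 0 ≤ I.paidCost h :=
  Finset.sum_nonneg fun j _ => Finset.sum_nonneg fun k _ => by
    split_ifs
    exacts [wcost_nonneg j k, le_rfl]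

lemma paidCost_cons (h : I.History) (j : Fin I.m) (r : ℝ) (hj : I.probed h j < I.len j) :
    I.paidCost ((j, r) :: h) = I.paidCost h + I.wcost j ⟨I.probed h j, hj⟩ := by
  have h1 : ∀ (j' : Fin I.m) (k : Fin (I.len j')),
      (if (k : ℕ) < I.probed ((j, r) :: h) j' then (1 - I.lam) * I.cost j' k else 0)
        = (if (k : ℕ) < I.probed h j' then (1 - I.lam) * I.cost j' k else 0)
          + if j = j' ∧ (k : ℕ) = I.probed h j' then I.wcost j' k else 0 := by
    intro j' k
    rw [probed_cons]
    by_cases hjj : j = j'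
    · rcases lt_trichotomy (k : ℕ) (I.probed h j') with hk | hk | hk
      · simp [hjj, hk, hk.ne, Nat.lt_succ_of_lt hk]
      · simp [hjj, hk, wcost]
      · simp [hjj, hk.not_gt, hk.ne', hk.not_ge]
    · simp [hjj]
  simp only [paidCost, h1, Finset.sum_add_distrib, add_right_inj]
  rw [Finset.sum_eq_single j, Finset.sum_eq_single ⟨I.probed h j, hj⟩]
  · simp
  · intro k _ hk
    rw [if_neg]
    exact fun h => hk (Fin.ext h.2)
  · simp
  · intro j' _ hj'
    exact Finset.sum_eq_zero fun k _ => if_neg fun h => hj' h.1.symm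
  · simp

lemma step_eq_cons {π : I.Policy} {h : I.History} {j : Fin I.m} (hπ : π h = some j)
    (hj : I.probed h j < I.len j) (ω : Ω) :
    I.step π ω h = (j, I.loss j ⟨I.probed h j, hj⟩ ω) :: h := by
  simp only [step, hπ, dif_pos hj]

lemma step_eq_self {π : I.Policy} {h : I.History}
    (hπ : ∀ j, π h = some j → ¬ I.probed h j < I.len j) (ω : Ω) : I.step π ω h = h := by
  cases hh : π h with
  | none => simp only [step, hh]
  | some j => simp only [step, hh, dif_neg (hπ j hh)]

/-- Either the policy probes an available node, or nothing happens. -/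
lemma step_cases (π : I.Policy) (h : I.History) :
    (∃ j, ∃ hj : I.probed h j < I.len j, π h = some j ∧
      ∀ ω, I.step π ω h = (j, I.loss j ⟨I.probed h j, hj⟩ ω) :: h) ∨
    ((∀ j, π h = some j → ¬ I.probed h j < I.len j) ∧ ∀ ω, I.step π ω h = h) := by
  by_cases hex : ∃ j, π h = some j ∧ I.probed h j < I.len j
  · obtain ⟨j, hπ, hj⟩ := hex
    exact Or.inl ⟨j, hj, hπ, step_eq_cons hπ hj⟩
  · have : ∀ j, π h = some j → ¬ I.probed h j < I.len j := fun j hπ hj => hex ⟨j, hπ, hj⟩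
    exact Or.inr ⟨this, step_eq_self this⟩

/-- Properties of the reachable histories. -/
lemma run_induction (π : I.Policy) (ω : Ω) {P : I.History → Prop} (h0 : P [])
    (hcons : ∀ h j (hj : I.probed h j < I.len j), P h →
      P ((j, I.loss j ⟨I.probed h j, hj⟩ ω) :: h)) (t : ℕ) : P (I.run π ω t) := by
  induction t with
  | zero => exact h0
  | succ t ih =>
    rw [run]
    rcases step_cases π (I.run π ω t) with ⟨j, hj, -, hs⟩ | ⟨-, hs⟩
    · rw [hs]
      exact hcons _ _ hj ih
    · rwa [hs]

lemma probed_run_le (π : I.Policy) (ω : Ω) (t : ℕ) (k : Fin I.m) :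
    I.probed (I.run π ω t) k ≤ I.len k := by
  refine run_induction π ω (P := fun h => I.probed h k ≤ I.len k) (by simp [probed])
    (fun h j hj ih => ?_) t
  rw [probed_cons]
  split_ifs with hjk
  · subst hjk
    exact hj
  · exact ih

lemma lastLoss_run (π : I.Policy) (ω : Ω) (t : ℕ) (k : Fin I.m) :
    I.lastLoss (I.run π ω t) k = I.prevLoss k (I.probed (I.run π ω t) k) (I.loss k · ω) := by
  refine run_induction π ω
    (P := fun h => I.lastLoss h k = I.prevLoss k (I.probed h k) (I.loss k · ω))
    (by simp [probed, lastLoss, prevLoss]) (fun h j hj ih => ?_) t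
  rw [probed_cons, lastLoss]
  split_ifs with hjk
  · subst hjk
    have : 0 < I.probed h j + 1 ∧ I.probed h j + 1 - 1 < I.len j := ⟨Nat.succ_pos _, hj⟩
    rw [prevLoss, dif_pos this]
    rfl
  · exact ih

/-- Needs a reachable history: only there do the recorded losses agree with the scenario. -/
lemma currentIndex_run (π : I.Policy) (ω : Ω) (t : ℕ) (k : Fin I.m) :
    I.currentIndex (I.run π ω t) k
      = I.indexAt k (I.probed (I.run π ω t) k) (I.loss k · ω) := by
  rw [currentIndex, indexAt, lastLoss_run]

lemma length_eq_sum_probed (h : I.History) : h.length = ∑ j, I.probed h j := by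
  induction h with
  | nil => simp [probed]
  | cons p h ih =>
    obtain ⟨j, r⟩ := p
    simp [probed_cons, Finset.sum_add_distrib, ← ih]

/-- The event that a given history has occurred depends only on the past. -/
lemma isPast_run_eq (π : I.Policy) (t : ℕ) (h : I.History) (j : Fin I.m) :
    I.IsPast j (I.probed h j) {ω | I.run π ω t = h} := by
  -- Compare the two runs step by step: until line `j` has been probed more than `probed h j` times,
  -- they have been shown only losses on which the scenarios agree.
  suffices key : ∀ ω ω', (∀ j' (k : Fin (I.len j')), (j' = j → (k : ℕ) < I.probed h j) →
      I.loss j' k ω = I.loss j' k ω') → ∀ t, I.probed (I.run π ω t) j ≤ I.probed h j →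
      I.run π ω t = I.run π ω' t by
    intro ω ω' hω hr
    rw [Set.mem_ofPred_eq] at hr ⊢
    rw [← key ω ω' hω t (by rw [hr]), hr]
  intro ω ω' hω t
  induction t with
  | zero => exact fun _ => rfl
  | succ t ih =>
    intro hle
    rw [run] at hle ⊢
    rw [run]
    rcases step_cases π (I.run π ω t) with ⟨j', hj', -, hs⟩ | ⟨-, hs⟩
    · rw [hs, probed_cons] at hle
      rw [← ih (by omega), hs, hs, hω j' ⟨_, hj'⟩ fun e => ?_]
      subst e
      simp only [if_pos] at hle
      exact hle
    · rw [hs] at hle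
      rw [← ih hle, hs, hs]

lemma determined_run (π : I.Policy) (t : ℕ) : I.Determined fun ω => I.run π ω t := by
  intro ω ω' h
  induction t with
  | zero => rfl
  | succ t ih =>
    simp only [run] at ih ⊢
    rw [← ih]
    simp only [step, h]

end Histories

/-! ### The potential: a submartingale for all policies, a martingale for index policies. -/

section Potential

variable {Ω : Type*} [MeasurableSpace Ω] {μ : Measure Ω} {I : MultiLineInstance Ω μ}

/-- The smaller of the best loss so far and the surrogate losses of what remains of the lines, plus
the cost paid so far. -/
noncomputable def potential (I : MultiLineInstance Ω μ) (h : I.History) (ω : Ω) : ℝ≥0∞ :=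
  min (I.bestLoss h) (⨅ k, I.surrogate k (I.probed h k) (I.loss k · ω))
    + ENNReal.ofReal (I.paidCost h)

/-- The best alternative to line `j`. -/
noncomputable def alternative (I : MultiLineInstance Ω μ) (h : I.History) (j : Fin I.m) (ω : Ω) :
    ℝ≥0∞ :=
  min (I.bestLoss h) (⨅ k, ⨅ _ : k ≠ j, I.surrogate k (I.probed h k) (I.loss k · ω))

lemma iInf_eq_min_iInf_ne {ι : Type*} (f : ι → ℝ≥0∞) (j : ι) :
    ⨅ k, f k = min (⨅ k, ⨅ _ : k ≠ j, f k) (f j) := by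
  refine le_antisymm (le_min (le_iInf₂ fun k _ => iInf_le f k) (iInf_le f j)) (le_iInf fun k => ?_)
  by_cases hk : k = j
  · exact hk ▸ min_le_right _ _
  · exact (min_le_left _ _).trans (iInf₂_le k hk)

lemma determined_alternative (h : I.History) (j : Fin I.m) : I.Determined (I.alternative h j) :=
  fun ω ω' hω => by simp only [alternative, hω]

lemma potential_eq (h : I.History) (j : Fin I.m) (ω : Ω) :
    I.potential h ω = min (I.alternative h j ω) (I.surrogate j (I.probed h j) (I.loss j · ω))
      + ENNReal.ofReal (I.paidCost h) := by
  rw [potential, alternative, iInf_eq_min_iInf_ne _ j, min_assoc]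

/-- The revealed loss enters `bestLoss` and combines with the remaining surrogate of line `j` into
`afterProbe`; the other lines keep their terms. -/
lemma potential_cons (h : I.History) (j : Fin I.m) (hj : I.probed h j < I.len j) (ω : Ω) :
    I.potential ((j, I.loss j ⟨I.probed h j, hj⟩ ω) :: h) ω
      = min (I.alternative h j ω) (I.afterProbe j ⟨I.probed h j, hj⟩ (I.loss j · ω))
        + ENNReal.ofReal (I.paidCost h) + ENNReal.ofReal (I.wcost j ⟨I.probed h j, hj⟩) := by
  have h1 : ⨅ k, ⨅ _ : k ≠ j, I.surrogate k
      (I.probed ((j, I.loss j ⟨I.probed h j, hj⟩ ω) :: h) k) (I.loss k · ω)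
      = ⨅ k, ⨅ _ : k ≠ j, I.surrogate k (I.probed h k) (I.loss k · ω) :=
    iInf_congr fun k => iInf_congr fun hk => by rw [probed_cons, if_neg hk.symm, add_zero]
  rw [potential_eq _ j, alternative, h1, bestLoss_cons, probed_cons, if_pos rfl,
    paidCost_cons h j _ hj, ENNReal.ofReal_add (paidCost_nonneg h) (wcost_nonneg _ _), alternative,
    afterProbe, ← add_assoc]
  congr 2
  simp only [min_assoc, min_left_comm, min_comm]

variable [IsProbabilityMeasure μ]

lemma setLIntegral_potential_step (π : I.Policy) (h : I.History) {A : Set Ω}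
    (hA : ∀ j, I.IsPast j (I.probed h j) A) :
    ∫⁻ ω in A, I.potential h ω ∂μ ≤ ∫⁻ ω in A, I.potential (I.step π ω h) ω ∂μ ∧
    (I.FollowsIndexAt π h →
      (∀ ω ∈ A, ∀ k, I.currentIndex h k = I.indexAt k (I.probed h k) (I.loss k · ω)) →
      ∫⁻ ω in A, I.potential h ω ∂μ = ∫⁻ ω in A, I.potential (I.step π ω h) ω ∂μ) := by
  rcases step_cases π h with ⟨j, hj, hπ, hs⟩ | ⟨-, hs⟩
  · simp only [hs, potential_cons, potential_eq h j]
    have hm := (determined_alternative h j).measurable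
    refine ⟨(fair j ⟨I.probed h j, hj⟩).setLIntegral_le (hA j) hm measurable_const,
      fun hf hidx => ?_⟩
    refine (fair j ⟨I.probed h j, hj⟩).setLIntegral_eq_of_index_le (hA j) hm measurable_const
      fun ω hω => ?_
    simp only [FollowsIndexAt, hπ] at hf
    have hi := hidx ω hω
    have hj' := hi j
    simp only
    rw [← hj']
    -- The probed index is at most the best loss and every other index, and those lie below their
    -- surrogates; this is the equality case of fairness.
    refine le_min hf.2.2 (le_iInf₂ fun k _ => (hf.2.1 k).trans ?_)
    rw [hi k]
    exact indexAt_le_surrogate _ _ _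
  · simp only [hs, le_refl, implies_true, and_self]

lemma lintegral_potential_succ (π : I.Policy) (t : ℕ) :
    ∫⁻ ω, I.potential (I.run π ω t) ω ∂μ ≤ ∫⁻ ω, I.potential (I.run π ω (t + 1)) ω ∂μ ∧
    (I.IsIndexPolicy π → ∫⁻ ω, I.potential (I.run π ω t) ω ∂μ
      = ∫⁻ ω, I.potential (I.run π ω (t + 1)) ω ∂μ) := by
  obtain ⟨H, hH⟩ := (determined_run π t).exists_setLIntegral_eq_sum
  have hsum : ∀ g : Ω → ℝ≥0∞, ∫⁻ ω, g ω ∂μ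
      = ∑ h ∈ H, ∫⁻ ω in {ω | I.run π ω t = h}, g ω ∂μ := fun g => by
    rw [← setLIntegral_univ, hH _ MeasurableSet.univ]
    simp only [Set.univ_inter]
    rfl
  have hmeas : ∀ h : I.History, MeasurableSet {ω | I.run π ω t = h} := fun h =>
    ((determined_run π t).preimage {h}).measurableSet
  have h1 : ∀ h, ∫⁻ ω in {ω | I.run π ω t = h}, I.potential (I.run π ω t) ω ∂μ
      = ∫⁻ ω in {ω | I.run π ω t = h}, I.potential h ω ∂μ := fun h =>
    setLIntegral_congr_fun (hmeas h) fun ω hω => by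
      rw [Set.mem_ofPred_eq] at hω
      simp only [hω]
  have h2 : ∀ h, ∫⁻ ω in {ω | I.run π ω t = h}, I.potential (I.run π ω (t + 1)) ω ∂μ
      = ∫⁻ ω in {ω | I.run π ω t = h}, I.potential (I.step π ω h) ω ∂μ := fun h =>
    setLIntegral_congr_fun (hmeas h) fun ω hω => by
      rw [Set.mem_ofPred_eq] at hω
      simp only [run, hω]
  rw [hsum, hsum fun ω => I.potential (I.run π ω (t + 1)) ω]
  simp only [h1, h2]
  have hstep := fun h =>
    setLIntegral_potential_step π h (fun j => isPast_run_eq π t h j)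
  refine ⟨Finset.sum_le_sum fun h _ => (hstep h).1, fun hind => Finset.sum_congr rfl fun h _ => ?_⟩
  -- The index rule holds only almost surely, so it may fail at a history of probability zero, but
  -- at no other.
  by_cases h0 : μ {ω | I.run π ω t = h} = 0
  · rw [setLIntegral_measure_zero _ _ h0, setLIntegral_measure_zero _ _ h0]
  · refine (hstep h).2 ?_ fun ω hω k => ?_
    · by_contra hf
      have hnull : μ {ω | ¬ ∀ t, I.FollowsIndexAt π (I.run π ω t)} = 0 := hind
      have hsub : {ω | I.run π ω t = h} ⊆ {ω | ¬ ∀ t, I.FollowsIndexAt π (I.run π ω t)} := by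
        intro ω hω hall
        rw [Set.mem_ofPred_eq] at hω
        exact hf (hω ▸ hall t)
      exact h0 (measure_mono_null hsub hnull)
    · rw [Set.mem_ofPred_eq] at hω
      rw [← hω]
      exact currentIndex_run π ω t k

lemma lintegral_potential_run (π : I.Policy) (t : ℕ) :
    ∫⁻ ω, I.potential [] ω ∂μ ≤ ∫⁻ ω, I.potential (I.run π ω t) ω ∂μ ∧
    (I.IsIndexPolicy π → ∫⁻ ω, I.potential [] ω ∂μ
      = ∫⁻ ω, I.potential (I.run π ω t) ω ∂μ) := by
  induction t with
  | zero => exact ⟨le_rfl, fun _ => rfl⟩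
  | succ t ih =>
    have h := lintegral_potential_succ (μ := μ) π t
    exact ⟨ih.1.trans h.1, fun hπ => (ih.2 hπ).trans (h.2 hπ)⟩

end Potential

/-! ### Optimality and existence of index policies. -/

section Optimality

variable {Ω : Type*} [MeasurableSpace Ω] {μ : Measure Ω} {I : MultiLineInstance Ω μ}

/-- A policy sees only the history, so a step without effect is repeated forever; until then each
step adds one entry. -/
lemma length_run_or_fixed (π : I.Policy) (ω : Ω) (t : ℕ) :
    (I.run π ω t).length = t ∨ I.step π ω (I.run π ω t) = I.run π ω t := by
  induction t with
  | zero => exact Or.inl rfl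
  | succ t ih =>
    rcases ih with ih | ih
    · rcases step_cases π (I.run π ω t) with ⟨j, hj, -, hs⟩ | ⟨-, hs⟩
      · exact Or.inl (by rw [run, hs, List.length_cons, ih])
      · exact Or.inr (by rw [run, hs, hs])
    · exact Or.inr (by rw [run, ih, ih])

/-- After as many steps as there are nodes the policy has stopped. -/
lemma not_available_finalHistory (π : I.Policy) (ω : Ω) (j : Fin I.m)
    (hπ : π (I.finalHistory π ω) = some j) :
    ¬ I.probed (I.finalHistory π ω) j < I.len j := by
  intro hj
  rcases length_run_or_fixed π ω (∑ j, I.len j) with h | h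
  · rw [length_eq_sum_probed] at h
    exact h.not_lt (Finset.sum_lt_sum (fun k _ => probed_run_le π ω _ k)
      ⟨j, Finset.mem_univ j, hj⟩)
  · have h' := congrArg List.length h
    rw [finalHistory] at hπ hj
    rw [step_eq_cons hπ hj, List.length_cons] at h'
    omega

/-- An index policy cannot ask for a probe here: it would name an available line, although all steps
are used up. It thus stops, with the best loss below every index and hence below every surrogate. -/
lemma potential_finalHistory {π : I.Policy} {ω : Ω}
    (hf : I.FollowsIndexAt π (I.finalHistory π ω)) :
    I.potential (I.finalHistory π ω) ω = I.bestLoss (I.finalHistory π ω)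
      + ENNReal.ofReal (I.paidCost (I.finalHistory π ω)) := by
  rw [potential, min_eq_left]
  refine le_iInf fun k => ?_
  cases hπ : π (I.finalHistory π ω) with
  | some j =>
    simp only [FollowsIndexAt, hπ] at hf
    exact absurd hf.1 (not_available_finalHistory π ω j hπ)
  | none =>
    simp only [FollowsIndexAt, hπ] at hf
    refine (hf k).trans ?_
    rw [finalHistory, currentIndex_run]
    exact indexAt_le_surrogate _ _ _

theorem IsIndexPolicy.isOptimal [IsProbabilityMeasure μ] {π : I.Policy} (hπ : I.IsIndexPolicy π) :
    I.IsOptimal π := by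
  intro π'
  have h1 : I.expectedLoss π = ∫⁻ ω, I.potential (I.finalHistory π ω) ω ∂μ :=
    lintegral_congr_ae (hπ.mono fun ω hω => (potential_finalHistory (hω _)).symm)
  rw [h1]
  simp only [finalHistory]
  rw [← (lintegral_potential_run π _).2 hπ]
  refine (lintegral_potential_run π' (∑ j, I.len j)).1.trans (lintegral_mono fun ω => ?_)
  exact add_le_add_left (min_le_left _ _) _

theorem exists_isIndexPolicy (I : MultiLineInstance Ω μ) : ∃ π : I.Policy, I.IsIndexPolicy π := by
  classical
  let Q : I.History → Fin I.m → Prop := fun h j => I.probed h j < I.len j ∧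
    (∀ k, I.currentIndex h j ≤ I.currentIndex h k) ∧ I.currentIndex h j ≤ I.bestLoss h
  let π : I.Policy := fun h => if hex : ∃ j, Q h j then some hex.choose else none
  refine ⟨π, Filter.Eventually.of_forall fun ω t => ?_⟩
  generalize I.run π ω t = h
  by_cases hex : ∃ j, Q h j
  · have : π h = some hex.choose := dif_pos hex
    simp only [FollowsIndexAt, this]
    exact hex.choose_spec
  · have : π h = none := dif_neg hex
    simp only [FollowsIndexAt, this]
    intro k
    by_contra hk
    have hne : Nonempty (Fin I.m) := ⟨k⟩
    obtain ⟨j, hj⟩ := Finite.exists_min (I.currentIndex h)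
    -- A line of minimal index qualifies for probing: its index is below the best loss, hence
    -- finite, so the line is not exhausted.
    have hlt : I.currentIndex h j < I.bestLoss h := (hj k).trans_lt (not_le.1 hk)
    refine hex ⟨j, ?_, hj, hlt.le⟩
    by_contra hav
    rw [currentIndex, dif_neg hav] at hlt
    exact not_top_lt hlt

end Optimality

end MultiLineInstance

theorem mainTheorem5 {Ω : Type*} [MeasurableSpace Ω] (μ : Measure Ω) [IsProbabilityMeasure μ]
    (I : MultiLineInstance Ω μ) :
    (∀ (j : Fin I.m) (i : Fin (I.len j)) (s : ℝ), μ (I.prevEvent j i s) ≠ 0 →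
      IsLeast (I.indexSolutions j i s) (I.dynamicIndex j i s)) ∧
    (∃ π : I.Policy, I.IsIndexPolicy π) ∧
    ∀ π : I.Policy, I.IsIndexPolicy π → I.IsOptimal π :=
  ⟨fun j i _ hs => MultiLineInstance.isLeast_dynamicIndex j i hs, I.exists_isIndexPolicy,
    fun _ hπ => hπ.isOptimal⟩
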